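/- Let $\mathbb C$ be a $\tau$-pretopos, i.e. a Barr-exact, extensive category with finite coproducts in which every relation $R \rightarrowtail A\times A$ on an object $A$ has a transitive closure (a smallest transitive relation on $A$ containing it). Let $\mathsf{PreOrd}(\mathbb C)$ be the category of internal preorders $(A,\rho)$ in $\mathbb C$ (reflexive and transitive relations $\rho\rightarrowtail A\times A$) and relation-preserving morphisms. A preorder is *trivial* if it is both an equivalence relation and a partial order (equivalently, $\rho$ is the discrete relation $\Delta_A$), and a morphism is *trivial* if it factors through a trivial object. A morphism $k\colon X\to Y$ is a *$\mathcal Z$-kernel* of $q\colon Y\to Z$ if $qk$ is trivial and every $\lambda\colon W\to Y$ with $q\lambda$ trivial factors uniquely through $k$; *$\mathcal Z$-cokernels* are defined dually. A sequence $X\xrightarrow{k}Y\xrightarrow{q}Z$ is *short $\mathcal Z$-exact* if $k$ is a $\mathcal Z$-kernel of $q$ and $q$ is a $\mathcal Z$-cokernel of $k$. Let $\mathsf{PaPreOrd}(\mathbb C)$ be the category with the same objects whose morphisms $A\to B$ are pairs $(\alpha,f)$, taken up to isomorphism of the domain $A'$, with $\alpha\colon A'\rightarrowtail A$ a complemented subobject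 in $\mathsf{PreOrd}(\mathbb C)$ and $f\colon A'\to B$ a morphism of $\mathsf{PreOrd}(\mathbb C)$; composition is by pullback. Write $(\alpha_1,f_1)\sim(\alpha_2,f_2)$, for $\alpha_i\colon A_i\rightarrowtail A$ and $f_i\colon A_i\to B$, if there are complemented subobjects $\alpha_0\colon A_0\rightarrowtail A$ and $\alpha_0^i\colon A_0\rightarrowtail A_i$ ($i=1,2$) with $\alpha_i\alpha_0^i=\alpha_0$, $f_1\alpha_0^1=f_2\alpha_0^2$, and such that the restriction of each $f_i$ to the complement of $A_0$ in $A_i$ is trivial. The *stable category* $\mathsf{Stab}(\mathbb C)$ is the quotient of $\mathsf{PaPreOrd}(\mathbb C)$ by the congruence $\sim$, and $\Sigma\colon\mathsf{PreOrd}(\mathbb C)\to\mathsf{Stab}(\mathbb C)$ is the functor that is the identity on objects and sends $f\colon A\to B$ to the class of $(1_A,f)$. The category $\mathsf{Stab}(\mathbb C)$ is pointed, with zero object the image under $\Sigma$ of the initial preorder. Then for any two composable morphisms $A\xrightarrow{f}B\xrightarrow{g}D$ in $\mathsf{Stab}(\mathbb C)$ the following are equivalent: 1. they form a short exact sequence,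 i.e. $f$ is a kernel of $g$ and $g$ is a cokernel of $f$; 2. there are a short $\mathcal Z$-exact sequence $X\xrightarrow{k}Y\xrightarrow{q}Z$ in $\mathsf{PreOrd}(\mathbb C)$ and isomorphisms $a\colon A\cong\Sigma(X)$, $b\colon B\cong\Sigma(Y)$, $d\colon D\cong\Sigma(Z)$ in $\mathsf{Stab}(\mathbb C)$ such that $b f=\Sigma(k)\,a$ and $d g=\Sigma(q)\,b$. -/

import Mathlib

open CategoryTheory CategoryTheory.Limits

universe v u

namespace StableCategory

/-- A pretopos: a category that is exact in the sense of Barr (regular, and every internal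
equivalence relation is a kernel pair), with finite coproducts, and extensive. -/
class Pretopos (C : Type u) [Category.{v} C] : Prop extends Regular C, FinitaryExtensive C where
  exists_isKernelPair : ∀ {R X : C} (p₁ p₂ : R ⟶ X), IsEquivalenceRelation p₁ p₂ →
    ∃ (Y : C) (q : X ⟶ Y), IsKernelPair q p₁ p₂

section Relations

variable {C : Type u} [Category.{v} C]

/-- Inclusion of relations on `A`, each given by a jointly monic pair. -/
def RelLE {R S A : C} (r₁ r₂ : R ⟶ A) (s₁ s₂ : S ⟶ A) : Prop :=
  ∃ i : R ⟶ S, i ≫ s₁ = r₁ ∧ i ≫ s₂ = r₂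

/-- `(t₁, t₂)` is the transitive closure of the relation `(r₁, r₂)` on `A`: the smallest
transitive relation that contains it. -/
structure IsTransitiveClosure {R T A : C} (r₁ r₂ : R ⟶ A) (t₁ t₂ : T ⟶ A) : Prop where
  transitive : Nonempty (TransitiveRelation t₁ t₂)
  le : RelLE r₁ r₂ t₁ t₂
  minimal : ∀ {S : C} (s₁ s₂ : S ⟶ A), Nonempty (TransitiveRelation s₁ s₂) →
    RelLE r₁ r₂ s₁ s₂ → RelLE t₁ t₂ s₁ s₂

end Relations

/-- A `τ`-pretopos: a pretopos in which every relation on an object has a transitive closure. -/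
class TauPretopos (C : Type u) [Category.{v} C] : Prop extends Pretopos C where
  exists_transitiveClosure : ∀ {R A : C} (r₁ r₂ : R ⟶ A), JointlyMono₂ r₁ r₂ →
    ∃ (T : C) (t₁ t₂ : T ⟶ A), IsTransitiveClosure r₁ r₂ t₁ t₂

/-! ### Internal preorders -/

/-- An internal preorder `(A, ρ)` in `C`: an object with a reflexive and transitive relation on it,
given by a jointly monic pair `fst, snd : rel ⟶ carrier`. -/
structure PreOrd (C : Type u) [Category.{v} C] where
  carrier : C
  rel : C
  fst : rel ⟶ carrier
  snd : rel ⟶ carrier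
  refl : Nonempty (ReflexiveRelation fst snd)
  trans : Nonempty (TransitiveRelation fst snd)

namespace PreOrd

section Basic

variable {C : Type u} [Category.{v} C]

/-- A morphism of internal preorders: a pair of compatible morphisms in `C`. -/
structure Hom (X Y : PreOrd C) where
  base : X.carrier ⟶ Y.carrier
  rel : X.rel ⟶ Y.rel
  rel_fst : rel ≫ Y.fst = X.fst ≫ base
  rel_snd : rel ≫ Y.snd = X.snd ≫ base

attribute [simp] Hom.rel_fst Hom.rel_snd

theorem rel_ext (X : PreOrd C) {T : C} {g h : T ⟶ X.rel} (h₁ : g ≫ X.fst = h ≫ X.fst)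
    (h₂ : g ≫ X.snd = h ≫ X.snd) : g = h :=
  X.refl.some.right_cancellation g h h₁ h₂

theorem exists_refl (X : PreOrd C) : ∃ r : X.carrier ⟶ X.rel, r ≫ X.fst = 𝟙 _ ∧ r ≫ X.snd = 𝟙 _ :=
  ⟨X.refl.some.r, X.refl.some.reflexivity₁, X.refl.some.reflexivity₂⟩

theorem exists_trans (X : PreOrd C) {T : C} (a b : T ⟶ X.rel) (w : a ≫ X.snd = b ≫ X.fst) :
    ∃ c : T ⟶ X.rel, c ≫ X.fst = a ≫ X.fst ∧ c ≫ X.snd = b ≫ X.snd := by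
  let t := X.trans.some
  refine ⟨PullbackCone.IsLimit.lift t.isLimit a b w ≫ t.t, ?_, ?_⟩
  · rw [Category.assoc, t.transitivity₁, ← Category.assoc, PullbackCone.IsLimit.lift_fst]
  · rw [Category.assoc, t.transitivity₂, ← Category.assoc, PullbackCone.IsLimit.lift_snd]

theorem Hom.ext_base {X Y : PreOrd C} {f g : Hom X Y} (h : f.base = g.base) : f = g := by
  have h' : f.rel = g.rel := Y.rel_ext (by simp [h]) (by simp [h])
  cases f; cases g; cases h; cases h'; rfl

instance : Category.{v} (PreOrd C) where
  Hom := Hom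
  id X := ⟨𝟙 _, 𝟙 _, by simp, by simp⟩
  comp f g := ⟨f.base ≫ g.base, f.rel ≫ g.rel,
    by rw [Category.assoc, g.rel_fst, ← Category.assoc, f.rel_fst, Category.assoc],
    by rw [Category.assoc, g.rel_snd, ← Category.assoc, f.rel_snd, Category.assoc]⟩
  id_comp f := Hom.ext_base (Category.id_comp _)
  comp_id f := Hom.ext_base (Category.comp_id _)
  assoc f g h := Hom.ext_base (Category.assoc _ _ _)

theorem hom_ext {X Y : PreOrd C} {f g : X ⟶ Y} (h : Hom.base f = Hom.base g) : f = g :=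
  Hom.ext_base h

@[simp] theorem id_base (X : PreOrd C) : Hom.base (𝟙 X) = 𝟙 X.carrier := rfl

@[simp] theorem comp_base {X Y Z : PreOrd C} (f : X ⟶ Y) (g : Y ⟶ Z) :
    Hom.base (f ≫ g) = Hom.base f ≫ Hom.base g := rfl

@[simp] theorem id_rel (X : PreOrd C) : Hom.rel (𝟙 X) = 𝟙 X.rel := rfl

@[simp] theorem comp_rel {X Y Z : PreOrd C} (f : X ⟶ Y) (g : Y ⟶ Z) :
    Hom.rel (f ≫ g) = Hom.rel f ≫ Hom.rel g := rfl

theorem mono_of_mono_base {X Y : PreOrd C} (f : X ⟶ Y) (h : Mono (Hom.base f)) : Mono f where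
  right_cancellation _ _ w := hom_ext ((cancel_mono (Hom.base f)).1 (congrArg Hom.base w))

/-! ### The pretorsion theory: equivalence relations, partial orders, trivial objects -/

/-- `(A, ρ)` is an equivalence relation: `ρ` has a symmetry. -/
def IsEq (X : PreOrd C) : Prop := Nonempty (SymmetricRelation X.fst X.snd)

/-- `(A, ρ)` is a partial order: the intersection of `ρ` and its opposite is the discrete
relation (expressed by generalised elements of that intersection). -/
def IsPar (X : PreOrd C) : Prop :=
  ∀ {T : C} (a b : T ⟶ X.rel), a ≫ X.fst = b ≫ X.snd → a ≫ X.snd = b ≫ X.fst →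
    a ≫ X.fst = a ≫ X.snd

/-- The trivial objects: preorders that are both equivalence relations and partial orders. -/
def IsTrivialObj (X : PreOrd C) : Prop := X.IsEq ∧ X.IsPar

/-- A morphism is trivial if it factors through a trivial object. -/
def IsTrivial {X Y : PreOrd C} (f : X ⟶ Y) : Prop :=
  ∃ (Z : PreOrd C) (a : X ⟶ Z) (b : Z ⟶ Y), Z.IsTrivialObj ∧ a ≫ b = f

/-- `k` is a kernel of `f` with respect to the ideal of trivial morphisms. -/
structure IsZKernel {X Y Z : PreOrd C} (k : X ⟶ Y) (f : Y ⟶ Z) : Prop where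
  trivial : IsTrivial (k ≫ f)
  existsUnique_lift : ∀ {W : PreOrd C} (l : W ⟶ Y), IsTrivial (l ≫ f) → ∃! l' : W ⟶ X, l' ≫ k = l

/-- `q` is a cokernel of `f` with respect to the ideal of trivial morphisms. -/
structure IsZCokernel {X Y Z : PreOrd C} (q : Y ⟶ Z) (f : X ⟶ Y) : Prop where
  trivial : IsTrivial (f ≫ q)
  existsUnique_desc : ∀ {W : PreOrd C} (l : Y ⟶ W), IsTrivial (f ≫ l) → ∃! l' : Z ⟶ W, q ≫ l' = l

/-- A short exact sequence with respect to the ideal of trivial morphisms. -/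
structure IsShortZExact {X Y Z : PreOrd C} (k : X ⟶ Y) (q : Y ⟶ Z) : Prop where
  isZKernel : IsZKernel k q
  isZCokernel : IsZCokernel q k

end Basic

/-! ### Constructions in the category of internal preorders -/

section Constructions

variable {C : Type u} [Category.{v} C]

/-- Build an internal preorder from generalised elements. -/
abbrev ofElements [HasPullbacks C] (A R : C) (r₁ r₂ : R ⟶ A)
    (jm : ∀ {T : C} (g h : T ⟶ R), g ≫ r₁ = h ≫ r₁ → g ≫ r₂ = h ≫ r₂ → g = h)
    (rf : ∃ r : A ⟶ R, r ≫ r₁ = 𝟙 A ∧ r ≫ r₂ = 𝟙 A)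
    (tr : ∀ {T : C} (a b : T ⟶ R), a ≫ r₂ = b ≫ r₁ →
      ∃ c : T ⟶ R, c ≫ r₁ = a ≫ r₁ ∧ c ≫ r₂ = b ≫ r₂) : PreOrd C where
  carrier := A
  rel := R
  fst := r₁
  snd := r₂
  refl := by
    obtain ⟨r, h₁, h₂⟩ := rf
    exact ⟨{ right_cancellation := fun _ g h => jm g h
             r := r
             reflexivity₁ := h₁
             reflexivity₂ := h₂ }⟩
  trans := by
    obtain ⟨c, h₁, h₂⟩ := tr (pullback.fst r₂ r₁) (pullback.snd r₂ r₁) pullback.condition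
    exact ⟨{ right_cancellation := fun _ g h => jm g h
             c := _
             isLimit := pullbackIsPullback r₂ r₁
             t := c
             transitivity₁ := h₁
             transitivity₂ := h₂ }⟩

/-- The discrete preorder on an object. -/
abbrev disc [HasPullbacks C] (A : C) : PreOrd C :=
  ofElements A A (𝟙 A) (𝟙 A) (fun g h w _ => by simpa using w) ⟨𝟙 A, by simp, by simp⟩
    (fun a b w => ⟨a, rfl, by simpa using w⟩)

/-- A morphism out of a discrete preorder. -/
noncomputable def discDesc [HasPullbacks C] {A : C} (X : PreOrd C) (f : A ⟶ X.carrier) :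
    disc A ⟶ X where
  base := f
  rel := f ≫ X.exists_refl.choose
  rel_fst := by simp [X.exists_refl.choose_spec.1]
  rel_snd := by simp [X.exists_refl.choose_spec.2]

@[simp] theorem discDesc_base [HasPullbacks C] {A : C} (X : PreOrd C) (f : A ⟶ X.carrier) :
    Hom.base (discDesc X f) = f := rfl

theorem mono_base [HasPullbacks C] {X Y : PreOrd C} (f : X ⟶ Y) [Mono f] : Mono (Hom.base f) where
  right_cancellation {T} g h w := by
    have : discDesc X g ≫ f = discDesc X h ≫ f := hom_ext w
    exact congrArg Hom.base ((cancel_mono f).1 this)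

attribute [local simp] pullback.map pullback.lift_fst pullback.lift_snd pullback.lift_fst_assoc
  pullback.lift_snd_assoc

theorem exists_isPullback [HasPullbacks C] {X Y Z : PreOrd C} (f : X ⟶ Z) (g : Y ⟶ Z) :
    ∃ (P : PreOrd C) (p : P ⟶ X) (q : P ⟶ Y), IsPullback p q f g ∧
      IsPullback (Hom.base p) (Hom.base q) (Hom.base f) (Hom.base g) ∧
      IsPullback (Hom.rel p) (Hom.rel q) (Hom.rel f) (Hom.rel g) := by
  have hf₁ := f.rel_fst
  have hf₂ := f.rel_snd
  have hg₁ := g.rel_fst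
  have hg₂ := g.rel_snd
  let P : PreOrd C := ofElements (pullback (Hom.base f) (Hom.base g))
    (pullback (Hom.rel f) (Hom.rel g))
    (pullback.map _ _ _ _ X.fst Y.fst Z.fst hf₁ hg₁)
    (pullback.map _ _ _ _ X.snd Y.snd Z.snd hf₂ hg₂)
    (by
      intro T a b w₁ w₂
      have u₁ := congrArg (· ≫ pullback.fst _ _) w₁
      have u₂ := congrArg (· ≫ pullback.fst _ _) w₂
      have v₁ := congrArg (· ≫ pullback.snd _ _) w₁
      have v₂ := congrArg (· ≫ pullback.snd _ _) w₂
      simp at u₁ u₂ v₁ v₂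
      apply pullback.hom_ext
      · exact X.rel_ext (by simpa using u₁) (by simpa using u₂)
      · exact Y.rel_ext (by simpa using v₁) (by simpa using v₂))
    (by
      obtain ⟨x, hx₁, hx₂⟩ := X.exists_refl
      obtain ⟨y, hy₁, hy₂⟩ := Y.exists_refl
      obtain ⟨z, hz₁, hz₂⟩ := Z.exists_refl
      refine ⟨pullback.map _ _ _ _ x y z ?_ ?_, ?_, ?_⟩
      · apply Z.rel_ext <;> simp [*] <;> simp [← Category.assoc, *]
      · apply Z.rel_ext <;> simp [*] <;> simp [← Category.assoc, *]
      · apply pullback.hom_ext <;> simp [*]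
      · apply pullback.hom_ext <;> simp [*])
    (by
      intro T a b w
      have u := congrArg (· ≫ pullback.fst _ _) w
      have v := congrArg (· ≫ pullback.snd _ _) w
      simp at u v
      obtain ⟨x, hx₁, hx₂⟩ := X.exists_trans (a ≫ pullback.fst _ _) (b ≫ pullback.fst _ _)
        (by simpa using u)
      obtain ⟨y, hy₁, hy₂⟩ := Y.exists_trans (a ≫ pullback.snd _ _) (b ≫ pullback.snd _ _)
        (by simpa using v)
      refine ⟨pullback.lift x y ?_, ?_, ?_⟩
      · apply Z.rel_ext
        · simp only [Category.assoc, hf₁, hg₁]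
          simp only [← Category.assoc, hx₁, hy₁]
          simp only [Category.assoc, ← hf₁, ← hg₁, pullback.condition_assoc]
        · simp only [Category.assoc, hf₂, hg₂]
          simp only [← Category.assoc, hx₂, hy₂]
          simp only [Category.assoc, ← hf₂, ← hg₂, pullback.condition_assoc]
      · apply pullback.hom_ext <;> simp [hx₁, hy₁]
      · apply pullback.hom_ext <;> simp [hx₂, hy₂])
  let p : P ⟶ X := ⟨pullback.fst _ _, pullback.fst _ _, by simp [P, ofElements],
    by simp [P, ofElements]⟩
  let q : P ⟶ Y := ⟨pullback.snd _ _, pullback.snd _ _, by simp [P, ofElements],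
    by simp [P, ofElements]⟩
  have w : p ≫ f = q ≫ g := hom_ext pullback.condition
  have sq : IsPullback p q f g := by
    refine ⟨⟨w⟩, ⟨PullbackCone.IsLimit.mk w (fun s => ⟨pullback.lift (Hom.base s.fst)
      (Hom.base s.snd) (congrArg Hom.base s.condition), pullback.lift (Hom.rel s.fst)
      (Hom.rel s.snd) (congrArg Hom.rel s.condition), ?_, ?_⟩) ?_ ?_ ?_⟩⟩
    · apply pullback.hom_ext <;> simp [P, ofElements]
    · apply pullback.hom_ext <;> simp [P, ofElements]
    · intro s
      apply hom_ext
      simp [p]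
    · intro s
      apply hom_ext
      simp [q]
    · intro s m h₁ h₂
      apply hom_ext
      apply pullback.hom_ext
      · simpa [p] using congrArg Hom.base h₁
      · simpa [q] using congrArg Hom.base h₂
  exact ⟨P, p, q, sq, IsPullback.of_hasPullback _ _, IsPullback.of_hasPullback _ _⟩

instance [HasPullbacks C] : HasPullbacks (PreOrd C) :=
  have : ∀ {X Y Z : PreOrd C} {f : X ⟶ Z} {g : Y ⟶ Z}, HasLimit (cospan f g) := fun {_ _ _ f g} =>
    let ⟨_, _, _, sq, _⟩ := exists_isPullback f g
    sq.hasPullback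
  hasPullbacks_of_hasLimit_cospan _

end Constructions

end PreOrd

/-! ### Coproducts in an extensive category -/

section Extensive

variable {C : Type u} [Category.{v} C]

/-- `i` and `j` are the coprojections of a binary coproduct. -/
def IsCoprod {X Y Z : C} (i : X ⟶ Z) (j : Y ⟶ Z) : Prop :=
  Nonempty (IsColimit (BinaryCofan.mk i j))

namespace IsCoprod

variable {X Y Z : C} {i : X ⟶ Z} {j : Y ⟶ Z}

theorem symm (h : IsCoprod i j) : IsCoprod j i :=
  ⟨BinaryCofan.isColimitFlip h.some⟩

theorem of_unique (hd : ∀ {W : C} (f : X ⟶ W) (g : Y ⟶ W), ∃ k : Z ⟶ W, i ≫ k = f ∧ j ≫ k = g)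
    (hu : ∀ {W : C} (k l : Z ⟶ W), i ≫ k = i ≫ l → j ≫ k = j ≫ l → k = l) : IsCoprod i j := by
  choose d h₁ h₂ using @hd
  exact ⟨BinaryCofan.isColimitMk (fun s => d s.inl s.inr) (fun s => h₁ _ _) (fun s => h₂ _ _)
    (fun s m w₁ w₂ => hu _ _ (w₁.trans (h₁ _ _).symm) (w₂.trans (h₂ _ _).symm))⟩

theorem hom_ext (h : IsCoprod i j) {W : C} {k l : Z ⟶ W} (h₁ : i ≫ k = i ≫ l)
    (h₂ : j ≫ k = j ≫ l) : k = l :=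
  BinaryCofan.IsColimit.hom_ext h.some h₁ h₂

theorem exists_desc (h : IsCoprod i j) {W : C} (f : X ⟶ W) (g : Y ⟶ W) :
    ∃ k : Z ⟶ W, i ≫ k = f ∧ j ≫ k = g :=
  ⟨BinaryCofan.IsColimit.desc h.some f g, BinaryCofan.IsColimit.inl_desc h.some f g,
    BinaryCofan.IsColimit.inr_desc h.some f g⟩

theorem of_iso (h : IsCoprod i j) {Z' : C} (e : Z ≅ Z') {i' : X ⟶ Z'} {j' : Y ⟶ Z'}
    (hi : i ≫ e.hom = i') (hj : j ≫ e.hom = j') : IsCoprod i' j' := by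
  subst hi hj
  refine of_unique (fun f g => ?_) (fun k l h₁ h₂ => ?_)
  · obtain ⟨k, h₁, h₂⟩ := h.exists_desc f g
    exact ⟨e.inv ≫ k, by simpa using h₁, by simpa using h₂⟩
  · simp only [Category.assoc] at h₁ h₂
    exact (cancel_epi e.hom).1 (h.hom_ext h₁ h₂)

/-- Associativity of binary coproducts. -/
theorem assoc (h : IsCoprod i j) {W Y' V : C} {k : Z ⟶ W} {l : Y' ⟶ W} (h' : IsCoprod k l)
    {a : Y ⟶ V} {b : Y' ⟶ V} (hV : IsCoprod a b) {m : V ⟶ W} (ha : a ≫ m = j ≫ k)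
    (hb : b ≫ m = l) : IsCoprod (i ≫ k) m := by
  refine of_unique (fun f g => ?_) (fun p q h₁ h₂ => ?_)
  · obtain ⟨s, hs₁, hs₂⟩ := h.exists_desc f (a ≫ g)
    obtain ⟨t, ht₁, ht₂⟩ := h'.exists_desc s (b ≫ g)
    refine ⟨t, by rw [Category.assoc, ht₁, hs₁], hV.hom_ext ?_ ?_⟩
    · rw [← Category.assoc, ha, Category.assoc, ht₁, hs₂]
    · rw [← Category.assoc, hb, ht₂]
  · refine h'.hom_ext (h.hom_ext (by simpa using h₁) ?_) ?_
    · rw [← Category.assoc, ← Category.assoc, ← ha, Category.assoc, Category.assoc, h₂]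
    · rw [← hb, Category.assoc, Category.assoc, h₂]

theorem inl_inr [HasBinaryCoproducts C] (X Y : C) :
    IsCoprod (coprod.inl : X ⟶ X ⨿ Y) coprod.inr :=
  ⟨coprodIsCoprod X Y⟩

variable [FinitaryExtensive C]

theorem mono_left (h : IsCoprod i j) : Mono i :=
  FinitaryExtensive.mono_inl_of_isColimit h.some

theorem mono_right (h : IsCoprod i j) : Mono j :=
  FinitaryExtensive.mono_inr_of_isColimit h.some

theorem pullback (h : IsCoprod i j) {T X' Y' : C} {g : T ⟶ Z} {i' : X' ⟶ T} {j' : Y' ⟶ T}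
    {x : X' ⟶ X} {y : Y' ⟶ Y} (hx : IsPullback i' x g i) (hy : IsPullback j' y g j) :
    IsCoprod i' j' :=
  ((BinaryCofan.isVanKampen_iff _).1 (FinitaryExtensive.vanKampen _ h.some)
    (BinaryCofan.mk i' j') x y g hx.w.symm hy.w.symm).2 ⟨hx, hy⟩

theorem isPullback (h : IsCoprod i j) {T X' Y' : C} {g : T ⟶ Z} {i' : X' ⟶ T} {j' : Y' ⟶ T}
    {x : X' ⟶ X} {y : Y' ⟶ Y} (hx : i' ≫ g = x ≫ i) (hy : j' ≫ g = y ≫ j)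
    (h' : IsCoprod i' j') : IsPullback i' x g i :=
  (((BinaryCofan.isVanKampen_iff _).1 (FinitaryExtensive.vanKampen _ h.some)
    (BinaryCofan.mk i' j') x y g hx.symm hy.symm).1 h').1

theorem isInitial (h : IsCoprod i j) {T : C} (x : T ⟶ X) (y : T ⟶ Y) (w : x ≫ i = y ≫ j) :
    Nonempty (IsInitial T) := by
  have sq := FinitaryExtensive.isPullback_initial_to_binaryCofan h.some
  have := initialIsInitial.isIso_to (sq.lift x y w)
  exact ⟨initialIsInitial.ofIso (asIso (sq.lift x y w)).symm⟩

variable [HasPullbacks C]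

/-- A generalised element of a coproduct splits its domain. -/
theorem split (h : IsCoprod i j) {T : C} (g : T ⟶ Z) :
    ∃ (T₁ T₂ : C) (t₁ : T₁ ⟶ T) (t₂ : T₂ ⟶ T) (x : T₁ ⟶ X) (y : T₂ ⟶ Y),
      IsCoprod t₁ t₂ ∧ t₁ ≫ g = x ≫ i ∧ t₂ ≫ g = y ≫ j :=
  ⟨_, _, pullback.fst g i, pullback.fst g j, pullback.snd g i, pullback.snd g j,
    h.pullback (IsPullback.of_hasPullback _ _) (IsPullback.of_hasPullback _ _),
    pullback.condition, pullback.condition⟩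

theorem eq_of_comp_eq (h : IsCoprod i j) {W : C} (d : Z ⟶ W) [Mono (i ≫ d)]
    (hd : ∀ {T : C} (x : T ⟶ X) (y : T ⟶ Y), x ≫ i ≫ d = y ≫ j ≫ d → Nonempty (IsInitial T))
    {T : C} (x : T ⟶ X) (k : T ⟶ Z) (w : (x ≫ i) ≫ d = k ≫ d) : x ≫ i = k := by
  obtain ⟨U₁, U₂, u₁, u₂, z, z', hu, hz, hz'⟩ := h.split k
  apply hu.hom_ext
  · have e : (u₁ ≫ x) ≫ i ≫ d = z ≫ i ≫ d := by
      rw [← Category.assoc z, ← hz, Category.assoc, Category.assoc, ← w, Category.assoc]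
    rw [hz, ← (cancel_mono _).1 e, Category.assoc]
  · have e : (u₂ ≫ x) ≫ i ≫ d = z' ≫ j ≫ d := by
      rw [← Category.assoc z', ← hz', Category.assoc, Category.assoc, ← w, Category.assoc]
    exact (hd _ _ e).some.hom_ext _ _

/-- The morphism out of a coproduct that is induced by two disjoint monomorphisms is monic. -/
theorem mono_of_disjoint (h : IsCoprod i j) {W : C} (d : Z ⟶ W) (hi : Mono (i ≫ d))
    (hj : Mono (j ≫ d))
    (hd : ∀ {T : C} (x : T ⟶ X) (y : T ⟶ Y), x ≫ i ≫ d = y ≫ j ≫ d → Nonempty (IsInitial T)) :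
    Mono d where
  right_cancellation g k w := by
    obtain ⟨T₁, T₂, t₁, t₂, x, y, ht, hx, hy⟩ := h.split g
    apply ht.hom_ext
    · rw [hx]
      exact h.eq_of_comp_eq d hd _ _ (by rw [← hx, Category.assoc, w, Category.assoc])
    · rw [hy]
      exact h.symm.eq_of_comp_eq d (fun a b e => hd b a e.symm) _ _
        (by rw [← hy, Category.assoc, w, Category.assoc])

end IsCoprod

end Extensive

namespace PreOrd

section Coproducts

variable {C : Type u} [Category.{v} C]

/-- Coproducts of preorders, computed on underlying objects and on relations. -/
structure IsSum {X Y Z : PreOrd C} (i : X ⟶ Z) (j : Y ⟶ Z) : Prop where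
  base : IsCoprod (Hom.base i) (Hom.base j)
  rel : IsCoprod (Hom.rel i) (Hom.rel j)

theorem IsSum.isCoprod {X Y Z : PreOrd C} {i : X ⟶ Z} {j : Y ⟶ Z} (h : IsSum i j) :
    IsCoprod i j := by
  refine IsCoprod.of_unique (fun f g => ?_) (fun k l h₁ h₂ => ?_)
  · obtain ⟨b, hb₁, hb₂⟩ := h.base.exists_desc (Hom.base f) (Hom.base g)
    obtain ⟨r, hr₁, hr₂⟩ := h.rel.exists_desc (Hom.rel f) (Hom.rel g)
    refine ⟨⟨b, r, ?_, ?_⟩, PreOrd.hom_ext hb₁, PreOrd.hom_ext hb₂⟩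
    · apply h.rel.hom_ext
      · rw [← Category.assoc, hr₁, ← Category.assoc, Hom.rel_fst, Hom.rel_fst, Category.assoc, hb₁]
      · rw [← Category.assoc, hr₂, ← Category.assoc, Hom.rel_fst, Hom.rel_fst, Category.assoc, hb₂]
    · apply h.rel.hom_ext
      · rw [← Category.assoc, hr₁, ← Category.assoc, Hom.rel_snd, Hom.rel_snd, Category.assoc, hb₁]
      · rw [← Category.assoc, hr₂, ← Category.assoc, Hom.rel_snd, Hom.rel_snd, Category.assoc, hb₂]
  · exact PreOrd.hom_ext (h.base.hom_ext (congrArg Hom.base h₁) (congrArg Hom.base h₂))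

variable [FinitaryExtensive C]

theorem isInitial_of_carrier {X : PreOrd C} (h : IsInitial X.carrier) : Nonempty (IsInitial X) := by
  have : IsIso X.fst := h.isIso_to X.fst
  have hr : IsInitial X.rel := h.ofIso (asIso X.fst).symm
  exact ⟨IsInitial.ofUniqueHom (fun Y => ⟨h.to _, hr.to _, hr.hom_ext _ _, hr.hom_ext _ _⟩)
    (fun _ _ => hom_ext (h.hom_ext _ _))⟩

variable [HasPullbacks C]

theorem exists_isSum (X Y : PreOrd C) :
    ∃ (Z : PreOrd C) (i : X ⟶ Z) (j : Y ⟶ Z), IsSum i j := by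
  have hb := IsCoprod.inl_inr X.carrier Y.carrier
  have hr := IsCoprod.inl_inr X.rel Y.rel
  have mi := hb.mono_left
  have mj := hb.mono_right
  obtain ⟨p₁, hp₁, hp₁'⟩ := hr.exists_desc (X.fst ≫ coprod.inl) (Y.fst ≫ coprod.inr)
  obtain ⟨p₂, hp₂, hp₂'⟩ := hr.exists_desc (X.snd ≫ coprod.inl) (Y.snd ≫ coprod.inr)
  have sq := hb.isPullback hp₁ hp₁' hr
  have sq' := hb.symm.isPullback hp₁' hp₁ hr.symm
  let Z : PreOrd C := ofElements (X.carrier ⨿ Y.carrier) (X.rel ⨿ Y.rel) p₁ p₂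
    (by
      intro T g h w₁ w₂
      obtain ⟨T₁, T₂, t₁, t₂, x, y, ht, hx, hy⟩ := hr.split g
      apply ht.hom_ext
      · have e : (t₁ ≫ h) ≫ p₁ = (x ≫ X.fst) ≫ coprod.inl := by
          rw [Category.assoc, ← w₁, ← Category.assoc, hx, Category.assoc, hp₁, Category.assoc]
        have hl := sq.lift_fst _ _ e
        rw [hx, ← hl]
        congr 1
        apply X.rel_ext
        · rw [sq.lift_snd]
        · rw [← cancel_mono (coprod.inl : X.carrier ⟶ X.carrier ⨿ Y.carrier), Category.assoc,
            Category.assoc, ← hp₂, ← Category.assoc, ← Category.assoc, ← hx, hl, Category.assoc,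
            Category.assoc, w₂]
      · have e : (t₂ ≫ h) ≫ p₁ = (y ≫ Y.fst) ≫ coprod.inr := by
          rw [Category.assoc, ← w₁, ← Category.assoc, hy, Category.assoc, hp₁', Category.assoc]
        have hl := sq'.lift_fst _ _ e
        rw [hy, ← hl]
        congr 1
        apply Y.rel_ext
        · rw [sq'.lift_snd]
        · rw [← cancel_mono (coprod.inr : Y.carrier ⟶ X.carrier ⨿ Y.carrier), Category.assoc,
            Category.assoc, ← hp₂', ← Category.assoc, ← Category.assoc, ← hy, hl, Category.assoc,
            Category.assoc, w₂])
    (by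
      obtain ⟨x, hx₁, hx₂⟩ := X.exists_refl
      obtain ⟨y, hy₁, hy₂⟩ := Y.exists_refl
      obtain ⟨r, h₁, h₂⟩ := hb.exists_desc (x ≫ coprod.inl) (y ≫ coprod.inr)
      refine ⟨r, hb.hom_ext ?_ ?_, hb.hom_ext ?_ ?_⟩
      · rw [← Category.assoc, h₁, Category.assoc, hp₁, ← Category.assoc, hx₁]; simp
      · rw [← Category.assoc, h₂, Category.assoc, hp₁', ← Category.assoc, hy₁]; simp
      · rw [← Category.assoc, h₁, Category.assoc, hp₂, ← Category.assoc, hx₂]; simp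
      · rw [← Category.assoc, h₂, Category.assoc, hp₂', ← Category.assoc, hy₂]; simp)
    (by
      intro T a b w
      obtain ⟨T₁, T₂, t₁, t₂, x, y, ht, hx, hy⟩ := hr.split a
      have e₁ : (t₁ ≫ b) ≫ p₁ = (x ≫ X.snd) ≫ coprod.inl := by
        rw [Category.assoc, ← w, ← Category.assoc, hx, Category.assoc, hp₂, Category.assoc]
      have e₂ : (t₂ ≫ b) ≫ p₁ = (y ≫ Y.snd) ≫ coprod.inr := by
        rw [Category.assoc, ← w, ← Category.assoc, hy, Category.assoc, hp₂', Category.assoc]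
      have hl₁ := sq.lift_fst _ _ e₁
      have hl₂ := sq'.lift_fst _ _ e₂
      obtain ⟨c₁, u₁, v₁⟩ := X.exists_trans x (sq.lift _ _ e₁) (sq.lift_snd _ _ e₁).symm
      obtain ⟨c₂, u₂, v₂⟩ := Y.exists_trans y (sq'.lift _ _ e₂) (sq'.lift_snd _ _ e₂).symm
      obtain ⟨c, h₁, h₂⟩ := ht.exists_desc (c₁ ≫ coprod.inl) (c₂ ≫ coprod.inr)
      refine ⟨c, ht.hom_ext ?_ ?_, ht.hom_ext ?_ ?_⟩
      · rw [← Category.assoc, h₁, Category.assoc, hp₁, ← Category.assoc, u₁, ← Category.assoc, hx,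
          Category.assoc, Category.assoc, hp₁]
      · rw [← Category.assoc, h₂, Category.assoc, hp₁', ← Category.assoc, u₂, ← Category.assoc, hy,
          Category.assoc, Category.assoc, hp₁']
      · rw [← Category.assoc, h₁, Category.assoc, hp₂, ← Category.assoc, v₁, Category.assoc, ← hp₂,
          ← Category.assoc, hl₁, Category.assoc]
      · rw [← Category.assoc, h₂, Category.assoc, hp₂', ← Category.assoc, v₂, Category.assoc, ← hp₂',
          ← Category.assoc, hl₂, Category.assoc])
  exact ⟨Z, ⟨coprod.inl, coprod.inl, hp₁, hp₂⟩, ⟨coprod.inr, coprod.inr, hp₁', hp₂'⟩, ⟨hb, hr⟩⟩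

/-- The initial preorder. -/
noncomputable def isInitialDisc : IsInitial (disc (⊥_ C)) :=
  IsInitial.ofUniqueHom (fun X => discDesc X (initial.to _))
    (fun _ _ => hom_ext (initialIsInitial.hom_ext _ _))

instance : HasInitial (PreOrd C) := isInitialDisc.hasInitial

theorem isInitial_carrier {X : PreOrd C} (f : X.carrier ⟶ (⊥_ (PreOrd C)).carrier) :
    Nonempty (IsInitial X.carrier) := by
  let g := f ≫ Hom.base (initialIsInitial.to (disc (⊥_ C)))
  have : IsIso g := initialIsInitial.isIso_to g
  exact ⟨initialIsInitial.ofIso (asIso g).symm⟩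

theorem isInitial_of_hom {X : PreOrd C} (f : X ⟶ ⊥_ (PreOrd C)) : Nonempty (IsInitial X) :=
  let ⟨h⟩ := isInitial_carrier (Hom.base f)
  isInitial_of_carrier h

instance : InitialMonoClass (PreOrd C) :=
  InitialMonoClass.of_initial fun _ =>
    ⟨fun g h _ => (isInitial_of_hom g).some.hom_ext g h⟩

/-! ### Complemented subobjects of internal preorders -/

/-- The monomorphisms `a : A ⟶ B` and `a' : A' ⟶ B` represent complementary subobjects of `B`
in the category of preorders: their intersection is `0` and their union is `B`. -/
def AreComplements {A A' B : PreOrd C} (a : A ⟶ B) (a' : A' ⟶ B) : Prop :=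
  ∃ (_ : Mono a) (_ : Mono a'), IsCompl (Subobject.mk a) (Subobject.mk a')

/-- The morphism `a : A ⟶ B` is (a monomorphism representing) a complemented subobject of `B`
in the category of preorders. -/
def IsComplementedMono {A B : PreOrd C} (a : A ⟶ B) : Prop :=
  ∃ (A' : PreOrd C) (a' : A' ⟶ B), AreComplements a a'

theorem IsSum.areComplements {A A' B : PreOrd C} {a : A ⟶ B} {a' : A' ⟶ B} (h : IsSum a a') :
    AreComplements a a' := by
  have m := mono_of_mono_base a h.base.mono_left
  have m' := mono_of_mono_base a' h.base.mono_right
  refine ⟨m, m', ⟨?_, ?_⟩⟩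
  · intro s hs hs'
    induction s using Subobject.ind with | _ s
    have w : Subobject.ofMkLEMk _ _ hs ≫ a = Subobject.ofMkLEMk _ _ hs' ≫ a' := by simp
    obtain ⟨hi⟩ := h.base.isInitial _ _ (congrArg Hom.base w)
    obtain ⟨hi'⟩ := isInitial_of_carrier hi
    rw [Subobject.bot_eq_initial_to]
    exact Subobject.mk_le_mk_of_comm (hi'.to _) (hi'.hom_ext _ _)
  · intro s hs hs'
    induction s using Subobject.ind with | _ s
    obtain ⟨d, h₁, h₂⟩ := h.isCoprod.exists_desc (Subobject.ofMkLEMk _ _ hs)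
      (Subobject.ofMkLEMk _ _ hs')
    have e : d ≫ s = 𝟙 _ := h.isCoprod.hom_ext (by rw [← Category.assoc, h₁]; simp)
      (by rw [← Category.assoc, h₂]; simp)
    rw [Subobject.top_eq_id]
    exact Subobject.mk_le_mk_of_comm d e

theorem AreComplements.isSum {A A' B : PreOrd C} {a : A ⟶ B} {a' : A' ⟶ B}
    (h : AreComplements a a') : IsSum a a' := by
  obtain ⟨m, m', hd, hc⟩ := h
  have mb := mono_base a
  have mb' := mono_base a'
  have meet : ∀ {T : C} (x : T ⟶ A.carrier) (y : T ⟶ A'.carrier),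
      x ≫ Hom.base a = y ≫ Hom.base a' → Nonempty (IsInitial T) := by
    intro T x y w
    have sq := IsPullback.of_hasPullback (Hom.base a) (Hom.base a')
    let p := discDesc A (pullback.fst (Hom.base a) (Hom.base a'))
    let p' := discDesc A' (pullback.snd (Hom.base a) (Hom.base a'))
    have hp : p ≫ a = p' ≫ a' := hom_ext pullback.condition
    have mp : Mono (p ≫ a) := mono_of_mono_base _ (by
      have : Mono (pullback.fst (Hom.base a) (Hom.base a')) := inferInstance
      exact mono_comp (pullback.fst (Hom.base a) (Hom.base a')) (Hom.base a))
    have hle := hd (Subobject.mk_le_mk_of_comm p rfl) (Subobject.mk_le_mk_of_comm p' hp.symm :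
      Subobject.mk (p ≫ a) ≤ Subobject.mk a')
    rw [Subobject.bot_eq_initial_to] at hle
    obtain ⟨hi⟩ := isInitial_carrier (Hom.base (Subobject.ofMkLEMk _ _ hle))
    have := hi.isIso_to (sq.lift x y w)
    exact ⟨hi.ofIso (asIso (sq.lift x y w)).symm⟩
  obtain ⟨S, i, j, hS⟩ := exists_isSum A A'
  obtain ⟨d, h₁, h₂⟩ := hS.isCoprod.exists_desc a a'
  have hb₁ := congrArg Hom.base h₁
  have hb₂ := congrArg Hom.base h₂
  simp only [comp_base] at hb₁ hb₂
  have md : Mono d := mono_of_mono_base d (hS.base.mono_of_disjoint _ (hb₁ ▸ mb) (hb₂ ▸ mb')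
    (fun x y w => meet x y (by rw [← hb₁, ← hb₂]; exact w)))
  have hle := hc (Subobject.mk_le_mk_of_comm i h₁) (Subobject.mk_le_mk_of_comm j h₂ :
    Subobject.mk a' ≤ Subobject.mk d)
  rw [Subobject.top_eq_id] at hle
  have hs : Subobject.ofMkLEMk _ _ hle ≫ d = 𝟙 B := Subobject.ofMkLEMk_comp hle
  have hs' : d ≫ Subobject.ofMkLEMk _ _ hle = 𝟙 S := by
    rw [← cancel_mono d, Category.assoc, hs, Category.comp_id, Category.id_comp]
  generalize Subobject.ofMkLEMk _ _ hle = s at hs hs'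
  exact ⟨hS.base.of_iso ⟨Hom.base d, Hom.base s, congrArg Hom.base hs', congrArg Hom.base hs⟩
      hb₁ hb₂,
    hS.rel.of_iso ⟨Hom.rel d, Hom.rel s, congrArg Hom.rel hs', congrArg Hom.rel hs⟩
      (congrArg Hom.rel h₁) (congrArg Hom.rel h₂)⟩

theorem AreComplements.symm {A A' B : PreOrd C} {a : A ⟶ B} {a' : A' ⟶ B}
    (h : AreComplements a a') : AreComplements a' a :=
  let ⟨m, m', hc⟩ := h
  ⟨m', m, hc.symm⟩

theorem IsComplementedMono.mono {A B : PreOrd C} {a : A ⟶ B} (h : IsComplementedMono a) :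
    Mono a :=
  let ⟨_, _, m, _⟩ := h
  m

theorem isComplementedMono_of_isIso {A B : PreOrd C} (a : A ⟶ B) [IsIso a] :
    IsComplementedMono a :=
  ⟨_, initial.to B, inferInstance, inferInstance, by
    have h : Subobject.mk a = ⊤ := (Subobject.isIso_iff_mk_eq_top a).1 inferInstance
    rw [h, ← Subobject.bot_eq_initial_to]
    exact ⟨disjoint_bot_right, codisjoint_top_left⟩⟩

theorem isComplementedMono_initial (B : PreOrd C) :
    IsComplementedMono (initial.to B) :=
  ⟨_, 𝟙 B, inferInstance, inferInstance, by
    rw [← Subobject.bot_eq_initial_to, ← Subobject.top_eq_id]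
    exact ⟨disjoint_bot_left, codisjoint_top_right⟩⟩

theorem IsComplementedMono.comp {A B D : PreOrd C} {a : A ⟶ B} {b : B ⟶ D}
    (ha : IsComplementedMono a) (hb : IsComplementedMono b) : IsComplementedMono (a ≫ b) := by
  obtain ⟨A', a', ha⟩ := ha
  obtain ⟨B', b', hb⟩ := hb
  obtain ⟨S, i, j, hS⟩ := exists_isSum A' B'
  obtain ⟨d, h₁, h₂⟩ := hS.isCoprod.exists_desc (a' ≫ b) b'
  exact ⟨S, d, IsSum.areComplements
    ⟨ha.isSum.base.assoc hb.isSum.base hS.base (congrArg Hom.base h₁) (congrArg Hom.base h₂),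
      ha.isSum.rel.assoc hb.isSum.rel hS.rel (congrArg Hom.rel h₁) (congrArg Hom.rel h₂)⟩⟩

theorem IsComplementedMono.of_isPullback {A B X P : PreOrd C} {a : A ⟶ B} {f : X ⟶ B} {p : P ⟶ X}
    {q : P ⟶ A} (sq : IsPullback p q f a) (ha : IsComplementedMono a) : IsComplementedMono p := by
  obtain ⟨A', a', ha⟩ := ha
  obtain ⟨Q, s, t, hQ, hQb, hQr⟩ := exists_isPullback f a
  obtain ⟨Q', s', t', hQ', hQb', hQr'⟩ := exists_isPullback f a'
  have h : IsComplementedMono s :=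
    ⟨Q', s', IsSum.areComplements ⟨ha.isSum.base.pullback hQb hQb', ha.isSum.rel.pullback hQr hQr'⟩⟩
  have e : (sq.isoIsPullback _ _ hQ).hom ≫ s = p := sq.isoIsPullback_hom_fst _ _ hQ
  rw [← e]
  exact (isComplementedMono_of_isIso _).comp h

end Coproducts

end PreOrd

/-! ### Partial morphisms of internal preorders -/

open PreOrd

section Partial

variable {C : Type u} [Category.{v} C] [FinitaryExtensive C] [HasPullbacks C]

/-- A representative of a partial morphism: a complemented subobject `incl : dom ⟶ A` and a
morphism `map : dom ⟶ B`. -/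
structure PartialMap (A B : PreOrd C) where
  dom : PreOrd C
  incl : dom ⟶ A
  isComplementedMono : IsComplementedMono incl
  map : dom ⟶ B

namespace PartialMap

/-- Two representatives give the same partial morphism if they differ by an isomorphism of
their domains. -/
def Equiv {A B : PreOrd C} (p q : PartialMap A B) : Prop :=
  ∃ e : p.dom ≅ q.dom, e.hom ≫ q.incl = p.incl ∧ e.hom ≫ q.map = p.map

instance setoid (A B : PreOrd C) : Setoid (PartialMap A B) where
  r := Equiv
  iseqv :=
    { refl := fun p => ⟨Iso.refl _, Category.id_comp _, Category.id_comp _⟩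
      symm := fun ⟨e, h₁, h₂⟩ => ⟨e.symm, by simp [← h₁], by simp [← h₂]⟩
      trans := fun ⟨e, h₁, h₂⟩ ⟨e', h₁', h₂'⟩ =>
        ⟨e ≪≫ e', by simp [h₁', h₁], by simp [h₂', h₂]⟩ }

/-- The total morphism given by a morphism of preorders. -/
def ofHom {A B : PreOrd C} (f : A ⟶ B) : PartialMap A B where
  dom := A
  incl := 𝟙 A
  isComplementedMono := isComplementedMono_of_isIso _
  map := f

/-- The composite along a given pullback square. -/
def compOf {A B D : PreOrd C} (p : PartialMap A B) (q : PartialMap B D) {P : PreOrd C}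
    {s : P ⟶ p.dom} {t : P ⟶ q.dom} (sq : IsPullback s t p.map q.incl) : PartialMap A D where
  dom := P
  incl := s ≫ p.incl
  isComplementedMono :=
    (IsComplementedMono.of_isPullback sq q.isComplementedMono).comp p.isComplementedMono
  map := t ≫ q.map

/-- Composition of partial morphisms, by pullback. -/
noncomputable def comp {A B D : PreOrd C} (p : PartialMap A B) (q : PartialMap B D) :
    PartialMap A D :=
  p.compOf q (IsPullback.of_hasPullback p.map q.incl)

theorem compOf_equiv {A B D : PreOrd C} {p p' : PartialMap A B} {q q' : PartialMap B D}
    (hp : p.Equiv p') (hq : q.Equiv q') {P P' : PreOrd C}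
    {s : P ⟶ p.dom} {t : P ⟶ q.dom} (sq : IsPullback s t p.map q.incl)
    {s' : P' ⟶ p'.dom} {t' : P' ⟶ q'.dom} (sq' : IsPullback s' t' p'.map q'.incl) :
    (p.compOf q sq).Equiv (p'.compOf q' sq') := by
  obtain ⟨e, h₁, h₂⟩ := hp
  obtain ⟨e', h₁', h₂'⟩ := hq
  have sq'' : IsPullback (s ≫ e.hom) (t ≫ e'.hom) p'.map q'.incl :=
    sq.of_iso (Iso.refl _) e e' (Iso.refl _) (by simp) (by simp) (by simp [h₂]) (by simp [h₁'])
  refine ⟨sq''.isoIsPullback _ _ sq', ?_, ?_⟩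
  · have := sq''.isoIsPullback_hom_fst _ _ sq'
    simp only [compOf]
    rw [← Category.assoc, this, Category.assoc, h₁]
  · have := sq''.isoIsPullback_hom_snd _ _ sq'
    simp only [compOf]
    rw [← Category.assoc, this, Category.assoc, h₂']

theorem Equiv.refl {A B : PreOrd C} (p : PartialMap A B) : p.Equiv p :=
  (setoid A B).refl p

theorem Equiv.symm {A B : PreOrd C} {p q : PartialMap A B} (h : p.Equiv q) : q.Equiv p :=
  (setoid A B).symm h

theorem Equiv.trans {A B : PreOrd C} {p q r : PartialMap A B} (h : p.Equiv q) (h' : q.Equiv r) :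
    p.Equiv r :=
  (setoid A B).trans h h'

theorem comp_equiv_compOf {A B D : PreOrd C} (p : PartialMap A B) (q : PartialMap B D)
    {P : PreOrd C} {s : P ⟶ p.dom} {t : P ⟶ q.dom} (sq : IsPullback s t p.map q.incl) :
    (p.comp q).Equiv (p.compOf q sq) :=
  compOf_equiv (.refl p) (.refl q) _ _

theorem comp_congr {A B D : PreOrd C} {p p' : PartialMap A B} {q q' : PartialMap B D}
    (hp : p.Equiv p') (hq : q.Equiv q') : (p.comp q).Equiv (p'.comp q') :=
  compOf_equiv hp hq _ _

theorem id_comp_equiv {A B : PreOrd C} (p : PartialMap A B) : ((ofHom (𝟙 A)).comp p).Equiv p := by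
  have sq : IsPullback p.incl (𝟙 p.dom) (ofHom (𝟙 A)).map p.incl :=
    IsPullback.id_vert p.incl
  exact (comp_equiv_compOf _ _ sq).trans
    ⟨Iso.refl _, by simp [compOf, ofHom], by simp [compOf]⟩

theorem comp_id_equiv {A B : PreOrd C} (p : PartialMap A B) : (p.comp (ofHom (𝟙 B))).Equiv p := by
  have sq : IsPullback (𝟙 p.dom) p.map p.map (ofHom (𝟙 B)).incl :=
    IsPullback.id_horiz p.map
  exact (comp_equiv_compOf _ _ sq).trans
    ⟨Iso.refl _, by simp [compOf], by simp [compOf, ofHom]⟩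

theorem assoc_equiv {A B D E : PreOrd C} (p : PartialMap A B) (q : PartialMap B D)
    (r : PartialMap D E) : ((p.comp q).comp r).Equiv (p.comp (q.comp r)) := by
  have sq₁ := IsPullback.of_hasPullback p.map q.incl
  have sq₂ := IsPullback.of_hasPullback q.map r.incl
  have sq₃ := IsPullback.of_hasPullback (pullback.snd p.map q.incl) (pullback.fst q.map r.incl)
  have h₁ := comp_equiv_compOf (p.comp q) r (sq₃.paste_vert sq₂)
  have h₂ := comp_equiv_compOf p (q.comp r) (sq₃.paste_horiz sq₁)
  refine h₁.trans (Equiv.trans ?_ h₂.symm)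
  exact ⟨Iso.refl _, by simp [compOf, comp], by simp [compOf, comp]⟩

end PartialMap

variable (C) in
/-- The category of internal preorders and partial morphisms; its objects are the internal
preorders. -/
structure PaPreOrd where
  of ::
  toPreOrd : PreOrd C

namespace PaPreOrd

/-- The partial morphism with a given representative. -/
def mk {A B : PreOrd C} (p : PartialMap A B) :
    _root_.Quotient (PartialMap.setoid A B) := _root_.Quotient.mk _ p

noncomputable instance : Category.{max u v} (PaPreOrd C) where
  Hom A B := _root_.Quotient (PartialMap.setoid A.toPreOrd B.toPreOrd)
  id A := mk (PartialMap.ofHom (𝟙 A.toPreOrd))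
  comp := _root_.Quotient.map₂ PartialMap.comp
    (fun _ _ hp _ _ hq => PartialMap.comp_congr hp hq)
  id_comp := by
    rintro A B ⟨p⟩
    exact _root_.Quotient.sound (PartialMap.id_comp_equiv p)
  comp_id := by
    rintro A B ⟨p⟩
    exact _root_.Quotient.sound (PartialMap.comp_id_equiv p)
  assoc := by
    rintro A B D E ⟨p⟩ ⟨q⟩ ⟨r⟩
    exact _root_.Quotient.sound (PartialMap.assoc_equiv p q r)

/-- The morphism of `PaPreOrd C` with a given representative. -/
def homMk {A B : PreOrd C} (p : PartialMap A B) : PaPreOrd.of A ⟶ PaPreOrd.of B := mk p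

theorem homMk_surjective {A B : PreOrd C} (f : PaPreOrd.of A ⟶ PaPreOrd.of B) :
    ∃ p : PartialMap A B, homMk p = f :=
  _root_.Quotient.exists_rep f

theorem homMk_eq_iff {A B : PreOrd C} (p q : PartialMap A B) : homMk p = homMk q ↔ p.Equiv q :=
  _root_.Quotient.eq (r := PartialMap.setoid A B)

theorem homMk_comp {A B D : PreOrd C} (p : PartialMap A B) (q : PartialMap B D) :
    homMk p ≫ homMk q = homMk (p.comp q) := rfl

theorem homMk_id (A : PreOrd C) : homMk (PartialMap.ofHom (𝟙 A)) = 𝟙 (PaPreOrd.of A) := rfl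

theorem isZero_initial : IsZero (PaPreOrd.of (⊥_ (PreOrd C))) where
  unique_to := by
    rintro ⟨B⟩
    refine ⟨⟨⟨homMk (PartialMap.ofHom (initial.to B))⟩, fun f => ?_⟩⟩
    obtain ⟨p, rfl⟩ := homMk_surjective f
    obtain ⟨hi⟩ := isInitial_of_hom p.incl
    exact (homMk_eq_iff _ _).2 ⟨hi.uniqueUpToIso initialIsInitial, hi.hom_ext _ _, hi.hom_ext _ _⟩
  unique_from := by
    rintro ⟨B⟩
    refine ⟨⟨⟨homMk ⟨_, initial.to B, isComplementedMono_initial B, 𝟙 _⟩⟩, fun f => ?_⟩⟩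
    obtain ⟨p, rfl⟩ := homMk_surjective f
    obtain ⟨hi⟩ := isInitial_of_hom p.map
    exact (homMk_eq_iff _ _).2 ⟨hi.uniqueUpToIso initialIsInitial, hi.hom_ext _ _, hi.hom_ext _ _⟩

end PaPreOrd

variable (C) in
/-- The functor from preorders to preorders with partial morphisms, sending `f : A ⟶ B` to the
total morphism `(𝟙 A, f)`. -/
noncomputable def toPaPreOrd : PreOrd C ⥤ PaPreOrd C where
  obj A := PaPreOrd.of A
  map f := PaPreOrd.homMk (PartialMap.ofHom f)
  map_id _ := rfl
  map_comp {A B D} f g := by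
    rw [PaPreOrd.homMk_comp, PaPreOrd.homMk_eq_iff]
    have sq : IsPullback (𝟙 A) f (PartialMap.ofHom f).map (PartialMap.ofHom g).incl :=
      IsPullback.id_horiz f
    exact PartialMap.Equiv.symm ((PartialMap.comp_equiv_compOf _ _ sq).trans
      ⟨Iso.refl _, by simp [PartialMap.compOf, PartialMap.ofHom],
        by simp [PartialMap.compOf, PartialMap.ofHom]⟩)

/-! ### The stable category -/

/-- A congruence diagram between two (representatives of) partial morphisms `A ⟶ B`. The object
`dom` and the morphisms `left`, `right` are a common complemented subobject of the two domains;
`leftCompl` and `rightCompl` are its complements in them. -/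
structure CongruenceDiagram {A B : PreOrd C} (p q : PartialMap A B) where
  dom : PreOrd C
  incl : dom ⟶ A
  left : dom ⟶ p.dom
  right : dom ⟶ q.dom
  domLeftCompl : PreOrd C
  leftCompl : domLeftCompl ⟶ p.dom
  domRightCompl : PreOrd C
  rightCompl : domRightCompl ⟶ q.dom
  isComplementedMono_incl : IsComplementedMono incl
  left_incl : left ≫ p.incl = incl
  right_incl : right ≫ q.incl = incl
  areComplements_left : AreComplements left leftCompl
  areComplements_right : AreComplements right rightCompl
  map_eq : left ≫ p.map = right ≫ q.map
  isTrivial_left : IsTrivial (leftCompl ≫ p.map)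
  isTrivial_right : IsTrivial (rightCompl ≫ q.map)

variable (C) in
/-- Two partial morphisms are equivalent if there is a congruence diagram between them. -/
def stableRel : HomRel (PaPreOrd C) := fun A B f g =>
  ∃ p q : PartialMap A.toPreOrd B.toPreOrd, PaPreOrd.homMk p = f ∧ PaPreOrd.homMk q = g ∧
    Nonempty (CongruenceDiagram p q)

variable (C) in
/-- The stable category: the quotient of the category of partial morphisms by `stableRel`. -/
abbrev Stab := CategoryTheory.Quotient (stableRel C)

variable (C) in
/-- The canonical functor from preorders to the stable category. -/
noncomputable def stabFunctor : PreOrd C ⥤ Stab C :=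
  toPaPreOrd C ⋙ CategoryTheory.Quotient.functor (stableRel C)

/-- The image of the initial preorder is a zero object of the stable category. -/
theorem isZero_stab : IsZero ((stabFunctor C).obj (⊥_ (PreOrd C))) where
  unique_to := by
    rintro ⟨B⟩
    refine ⟨⟨⟨(CategoryTheory.Quotient.functor (stableRel C)).map
      (PaPreOrd.isZero_initial.to_ B)⟩, fun f => ?_⟩⟩
    obtain ⟨f, rfl⟩ := (CategoryTheory.Quotient.functor (stableRel C)).map_surjective f
    exact congrArg _ (PaPreOrd.isZero_initial.eq_to f)
  unique_from := by
    rintro ⟨B⟩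
    refine ⟨⟨⟨(CategoryTheory.Quotient.functor (stableRel C)).map
      (PaPreOrd.isZero_initial.from_ B)⟩, fun f => ?_⟩⟩
    obtain ⟨f, rfl⟩ := (CategoryTheory.Quotient.functor (stableRel C)).map_surjective f
    exact congrArg _ (PaPreOrd.isZero_initial.eq_from f)

/-- The zero morphisms of the stable category: those that factor through the zero object. -/
noncomputable instance : HasZeroMorphisms (Stab C) := isZero_stab.hasZeroMorphisms

end Partial

/-- A short exact sequence in a category with zero morphisms: `f` is a kernel of `g` and `g` is a
cokernel of `f`. -/
structure IsShortExact {D : Type*} [Category* D] [HasZeroMorphisms D] {X Y Z : D} (f : X ⟶ Y)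
    (g : Y ⟶ Z) : Prop where
  zero : f ≫ g = 0
  isKernel : Nonempty (IsLimit (KernelFork.ofι f zero))
  isCokernel : Nonempty (IsColimit (CokernelCofork.ofπ g zero))

end StableCategory

open CategoryTheory StableCategory

/-!
Write `Σ` for the functor `stabFunctor C` from preorders to the stable category. The proof rests on
three facts.

*Every morphism of the stable category is isomorphic to one of the form `Σ u`.* A partial morphism
from `A` to `B` is the same as a total morphism from `A` to the sum of `B` and a point
(`PartialMap.total`), the complement of its domain being sent to the point. Under this
correspondence two partial morphisms are related by a congruence diagram precisely when their total
morphisms agree on a complemented subobject of `A` and are trivial on its complement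
(`stableRel_homMk_iff`). This relation between total morphisms is easily seen to be a congruence, so it
describes equality in the stable category (`stabMk_eq_iff`); in particular `Σ u = 0` if and only if
`u` is trivial (`stabFunctor_map_eq_zero_iff`). Moreover `Σ` inverts the inclusion of `B` in the sum
of `B` and a point (`withPointIso`).

*`Σ` sends `Z`-kernels to kernels and `Z`-cokernels to cokernels* (`IsZKernel.existsUnique_stab`,
`IsZCokernel.existsUnique_stab`). Existence of factorisations is immediate from the first fact.
Uniqueness for kernels holds as `Σ` preserves monomorphisms. For a `Z`-cokernel `q : Y ⟶ Z` the
point is that a decomposition `Y = Y₀ ⊔ Y₁` is a morphism from `Y` to the sum of two points, which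
is a trivial object; hence it factors through `q`, and the decomposition descends to `Z`. No
description of `q` is needed.

*`Z`-kernels and `Z`-cokernels exist* (`PreOrd.exists_isZKernel`, `PreOrd.exists_isZCokernel`). The
latter is where transitive closures and exactness enter: they provide the preorder generated by a
span, whence coequalizers and the preorder on the quotient.

By the second fact a short `Z`-exact sequence gives a short exact sequence. Conversely, if
`f` and `g` form a short exact sequence, write `g` as `Σ u` up to isomorphism, let `k` be the
`Z`-kernel of `u` and `q` the `Z`-cokernel of `k`. Then `k` is also the `Z`-kernel of `q`, and
uniqueness of kernels and cokernels identifies `f` with `Σ k` and `g` with `Σ q`.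
-/

namespace StableCategory

namespace PreOrd

/-! ### Trivial morphisms -/

section Trivial

variable {C : Type u} [Category.{v} C]

theorem IsTrivialObj.fst_eq_snd {X : PreOrd C} (h : X.IsTrivialObj) : X.fst = X.snd := by
  obtain ⟨⟨s⟩, hp⟩ := h
  simpa using hp (𝟙 _) s.s (by simp [s.symmetry₂]) (by simp [s.symmetry₁])

theorem isTrivialObj_of_fst_eq_snd {X : PreOrd C} (h : X.fst = X.snd) : X.IsTrivialObj :=
  ⟨⟨{ right_cancellation := X.refl.some.right_cancellation
      s := 𝟙 _
      symmetry₁ := by simp [h]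
      symmetry₂ := by simp [h] }⟩, fun a _ _ _ => by rw [h]⟩

/-- A morphism is trivial precisely when it identifies any two related generalised elements: it
then factors through the discrete preorder on its codomain. -/
theorem isTrivial_iff [HasPullbacks C] {X Y : PreOrd C} (f : X ⟶ Y) :
    IsTrivial f ↔ X.fst ≫ Hom.base f = X.snd ≫ Hom.base f := by
  constructor
  · rintro ⟨Z, a, b, hZ, rfl⟩
    rw [comp_base, ← Category.assoc, ← Category.assoc, ← a.rel_fst, ← a.rel_snd, hZ.fst_eq_snd]
  · intro h
    exact ⟨disc Y.carrier, ⟨Hom.base (Y := Y) f, X.fst ≫ Hom.base (Y := Y) f, by simp, by simp [h]⟩,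
      discDesc Y (𝟙 _), isTrivialObj_of_fst_eq_snd rfl, hom_ext (by simp)⟩

theorem IsTrivial.comp_left {W X Y : PreOrd C} {f : X ⟶ Y} (h : IsTrivial f) (g : W ⟶ X) :
    IsTrivial (g ≫ f) := by
  obtain ⟨Z, a, b, hZ, rfl⟩ := h
  exact ⟨Z, g ≫ a, b, hZ, Category.assoc _ _ _⟩

theorem IsTrivial.comp_right {X Y Z : PreOrd C} {f : X ⟶ Y} (h : IsTrivial f) (g : Y ⟶ Z) :
    IsTrivial (f ≫ g) := by
  obtain ⟨T, a, b, hT, rfl⟩ := h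
  exact ⟨T, a, b ≫ g, hT, (Category.assoc _ _ _).symm⟩

theorem isTrivial_of_comp_mono [HasPullbacks C] {X Y Z : PreOrd C} {f : X ⟶ Y} (g : Y ⟶ Z) [Mono g]
    (h : IsTrivial (f ≫ g)) : IsTrivial f := by
  have := mono_base g
  rw [isTrivial_iff] at h ⊢
  rw [← cancel_mono (Hom.base g)]
  simpa using h

theorem isTrivial_of_isInitial [HasPullbacks C] {X Y : PreOrd C} (h : IsInitial X) (f : X ⟶ Y) :
    IsTrivial f :=
  ⟨disc Y.carrier, h.to _, discDesc Y (𝟙 _), isTrivialObj_of_fst_eq_snd rfl, h.hom_ext _ _⟩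

theorem IsTrivialObj.isTrivial {X Y : PreOrd C} (h : X.IsTrivialObj) (f : X ⟶ Y) : IsTrivial f :=
  ⟨X, 𝟙 X, f, h, Category.id_comp f⟩

theorem IsZKernel.mono {X Y Z : PreOrd C} {k : X ⟶ Y} {q : Y ⟶ Z} (h : IsZKernel k q) :
    Mono k where
  right_cancellation u v w := by
    have ht : IsTrivial ((v ≫ k) ≫ q) := by
      rw [Category.assoc]
      exact h.trivial.comp_left v
    exact (h.existsUnique_lift _ ht).unique w rfl

theorem IsZCokernel.epi {X Y Z : PreOrd C} {k : X ⟶ Y} {q : Y ⟶ Z} (h : IsZCokernel q k) :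
    Epi q where
  left_cancellation u v w := by
    have ht : IsTrivial (k ≫ q ≫ v) := by
      rw [← Category.assoc]
      exact h.trivial.comp_right v
    exact (h.existsUnique_desc _ ht).unique w rfl

/-- A `Z`-kernel is the `Z`-kernel of any of its `Z`-cokernels. -/
theorem IsZKernel.isShortZExact {X Y Z Z' : PreOrd C} {k : X ⟶ Y} {p : Y ⟶ Z} {q : Y ⟶ Z'}
    (hk : IsZKernel k p) (hq : IsZCokernel q k) : IsShortZExact k q where
  isZKernel :=
    { trivial := hq.trivial
      existsUnique_lift := fun l hl => by
        obtain ⟨r, rfl, -⟩ := hq.existsUnique_desc p hk.trivial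
        exact hk.existsUnique_lift l (by simpa using hl.comp_right r) }
  isZCokernel := hq

end Trivial

/-! ### Sums of preorders -/

section Sums

variable {C : Type u} [Category.{v} C]

theorem IsSum.symm {X Y Z : PreOrd C} {i : X ⟶ Z} {j : Y ⟶ Z} (h : IsSum i j) : IsSum j i :=
  ⟨h.base.symm, h.rel.symm⟩

theorem isPullback_of_base_of_rel {P X Y Z : PreOrd C} {p : P ⟶ X} {q : P ⟶ Y} {f : X ⟶ Z}
    {g : Y ⟶ Z} (hb : IsPullback (Hom.base p) (Hom.base q) (Hom.base f) (Hom.base g))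
    (hr : IsPullback (Hom.rel p) (Hom.rel q) (Hom.rel f) (Hom.rel g)) : IsPullback p q f g := by
  have w : p ≫ f = q ≫ g := hom_ext hb.w
  refine ⟨⟨w⟩, ⟨PullbackCone.IsLimit.mk w (fun s => ⟨hb.lift (Hom.base s.fst)
      (Hom.base s.snd) (congrArg Hom.base s.condition), hr.lift (Hom.rel s.fst)
      (Hom.rel s.snd) (congrArg Hom.rel s.condition), ?_, ?_⟩) ?_ ?_ ?_⟩⟩
  · apply hb.hom_ext
    · simp only [Category.assoc, ← Hom.rel_fst, hb.lift_fst]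
      rw [← Category.assoc, hr.lift_fst, Hom.rel_fst]
    · simp only [Category.assoc, ← Hom.rel_fst, hb.lift_snd]
      rw [← Category.assoc, hr.lift_snd, Hom.rel_fst]
  · apply hb.hom_ext
    · simp only [Category.assoc, ← Hom.rel_snd, hb.lift_fst]
      rw [← Category.assoc, hr.lift_fst, Hom.rel_snd]
    · simp only [Category.assoc, ← Hom.rel_snd, hb.lift_snd]
      rw [← Category.assoc, hr.lift_snd, Hom.rel_snd]
  · exact fun s => hom_ext (hb.lift_fst _ _ _)
  · exact fun s => hom_ext (hb.lift_snd _ _ _)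
  · intro s m h₁ h₂
    apply hom_ext
    apply hb.hom_ext
    · simpa using congrArg Hom.base h₁
    · simpa using congrArg Hom.base h₂

theorem IsSum.isTrivial_of_comp [HasPullbacks C] {X Y Z W : PreOrd C} {i : X ⟶ Z} {j : Y ⟶ Z}
    (h : IsSum i j) {f : Z ⟶ W} (hi : IsTrivial (i ≫ f)) (hj : IsTrivial (j ≫ f)) :
    IsTrivial f := by
  rw [isTrivial_iff] at *
  rw [comp_base, ← Category.assoc, ← Category.assoc, ← Hom.rel_fst, ← Hom.rel_snd, Category.assoc,
    Category.assoc] at hi hj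
  exact h.rel.hom_ext hi hj

theorem IsSum.isTrivialObj {X Y Z : PreOrd C} {i : X ⟶ Z} {j : Y ⟶ Z}
    (h : IsSum i j) (hX : X.IsTrivialObj) (hY : Y.IsTrivialObj) : Z.IsTrivialObj :=
  isTrivialObj_of_fst_eq_snd <| h.rel.hom_ext
    (by rw [Hom.rel_fst, Hom.rel_snd, hX.fst_eq_snd]) (by rw [Hom.rel_fst, Hom.rel_snd, hY.fst_eq_snd])

theorem IsSum.assoc {X Y Z W Y' V : PreOrd C} {i : X ⟶ Z} {j : Y ⟶ Z} (h : IsSum i j)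
    {k : Z ⟶ W} {l : Y' ⟶ W} (h' : IsSum k l) {a : Y ⟶ V} {b : Y' ⟶ V} (hV : IsSum a b)
    {m : V ⟶ W} (ha : a ≫ m = j ≫ k) (hb : b ≫ m = l) : IsSum (i ≫ k) m :=
  ⟨h.base.assoc h'.base hV.base (congrArg Hom.base ha) (congrArg Hom.base hb),
    h.rel.assoc h'.rel hV.rel (congrArg Hom.rel ha) (congrArg Hom.rel hb)⟩

variable [FinitaryExtensive C]

theorem IsSum.mono_left {X Y Z : PreOrd C} {i : X ⟶ Z} {j : Y ⟶ Z} (h : IsSum i j) : Mono i :=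
  mono_of_mono_base i h.base.mono_left

theorem IsSum.isInitial {X Y Z T : PreOrd C} {i : X ⟶ Z} {j : Y ⟶ Z} (h : IsSum i j)
    (x : T ⟶ X) (y : T ⟶ Y) (w : x ≫ i = y ≫ j) : Nonempty (IsInitial T) :=
  let ⟨hT⟩ := h.base.isInitial (Hom.base x) (Hom.base y) (congrArg Hom.base w)
  isInitial_of_carrier hT

theorem IsSum.isPullback {X Y Z : PreOrd C} {i : X ⟶ Z} {j : Y ⟶ Z} (h : IsSum i j)
    {T X' Y' : PreOrd C} {g : T ⟶ Z} {i' : X' ⟶ T} {j' : Y' ⟶ T}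
    {x : X' ⟶ X} {y : Y' ⟶ Y} (hx : i' ≫ g = x ≫ i) (hy : j' ≫ g = y ≫ j)
    (h' : IsSum i' j') : IsPullback i' x g i :=
  isPullback_of_base_of_rel
    (h.base.isPullback (congrArg Hom.base hx) (congrArg Hom.base hy) h'.base)
    (h.rel.isPullback (congrArg Hom.rel hx) (congrArg Hom.rel hy) h'.rel)

theorem IsSum.isPullback_right {X Y Z : PreOrd C} {i : X ⟶ Z} {j : Y ⟶ Z} (h : IsSum i j)
    {T X' Y' : PreOrd C} {g : T ⟶ Z} {i' : X' ⟶ T} {j' : Y' ⟶ T}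
    {x : X' ⟶ X} {y : Y' ⟶ Y} (hx : i' ≫ g = x ≫ i) (hy : j' ≫ g = y ≫ j)
    (h' : IsSum i' j') : IsPullback j' y g j :=
  h.symm.isPullback hy hx h'.symm

theorem IsSum.isInitial_of_isIso {X Y Z : PreOrd C} {i : X ⟶ Z} {j : Y ⟶ Z} (h : IsSum i j)
    [IsIso i] : Nonempty (IsInitial Y) :=
  h.isInitial (j ≫ inv i) (𝟙 Y) (by simp)

variable [HasPullbacks C]

/-- A morphism into a sum of preorders splits its domain. -/
theorem IsSum.split {X Y Z : PreOrd C} {i : X ⟶ Z} {j : Y ⟶ Z} (h : IsSum i j)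
    {T : PreOrd C} (g : T ⟶ Z) :
    ∃ (T₁ T₂ : PreOrd C) (t₁ : T₁ ⟶ T) (t₂ : T₂ ⟶ T) (x : T₁ ⟶ X) (y : T₂ ⟶ Y),
      IsSum t₁ t₂ ∧ t₁ ≫ g = x ≫ i ∧ t₂ ≫ g = y ≫ j := by
  obtain ⟨P, s, t, hP, hPb, hPr⟩ := exists_isPullback g i
  obtain ⟨P', s', t', hP', hPb', hPr'⟩ := exists_isPullback g j
  exact ⟨P, P', s, s', t, t', ⟨h.base.pullback hPb hPb', h.rel.pullback hPr hPr'⟩, hP.w, hP'.w⟩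

end Sums

/-! ### Adding a point -/

section WithPoint

variable {C : Type u} [Category.{v} C] [HasPullbacks C] [HasTerminal C]

variable (C) in
/-- The terminal preorder. -/
noncomputable def one : PreOrd C := disc (⊤_ C)

/-- The morphism to the terminal preorder. -/
noncomputable def toOne (X : PreOrd C) : X ⟶ one C where
  base := terminal.from _
  rel := terminal.from _
  rel_fst := terminal.hom_ext _ _
  rel_snd := terminal.hom_ext _ _

theorem toOne_unique {X : PreOrd C} (f g : X ⟶ one C) : f = g :=
  hom_ext (terminal.hom_ext (C := C) _ _)

variable (C) in
theorem isTrivialObj_one : (one C).IsTrivialObj := isTrivialObj_of_fst_eq_snd rfl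

variable [FinitaryExtensive C]

/-- The sum of a preorder and the terminal preorder. Partial morphisms into `B` correspond to
total morphisms into `withPoint B`. -/
noncomputable def withPoint (B : PreOrd C) : PreOrd C := (exists_isSum B (one C)).choose

/-- The inclusion of a preorder in its sum with the terminal preorder. -/
noncomputable def inl (B : PreOrd C) : B ⟶ withPoint B :=
  (exists_isSum B (one C)).choose_spec.choose

/-- The added point. -/
noncomputable def point (B : PreOrd C) : one C ⟶ withPoint B :=
  (exists_isSum B (one C)).choose_spec.choose_spec.choose

theorem isSum_withPoint (B : PreOrd C) : IsSum (inl B) (point B) :=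
  (exists_isSum B (one C)).choose_spec.choose_spec.choose_spec

instance (B : PreOrd C) : Mono (inl B) := (isSum_withPoint B).mono_left

theorem isTrivial_point {A B : PreOrd C} (f : A ⟶ one C) : IsTrivial (f ≫ point B) :=
  ((isTrivialObj_one C).isTrivial _).comp_left f

end WithPoint

end PreOrd

open PreOrd

/-! ### Stable equality of total morphisms -/

section StablyEq

variable {C : Type u} [Category.{v} C]

/-- Two morphisms of preorders are stably equal if they agree on a complemented subobject of
their domain and are both trivial on its complement. -/
def StablyEq {A B : PreOrd C} (u v : A ⟶ B) : Prop :=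
  ∃ (A₀ A₁ : PreOrd C) (i : A₀ ⟶ A) (j : A₁ ⟶ A), IsSum i j ∧ i ≫ u = i ≫ v ∧
    IsTrivial (j ≫ u) ∧ IsTrivial (j ≫ v)

namespace StablyEq

variable {A B D : PreOrd C}

theorem symm {u v : A ⟶ B} : StablyEq u v → StablyEq v u :=
  fun ⟨_, _, i, j, h, e, h₁, h₂⟩ => ⟨_, _, i, j, h, e.symm, h₂, h₁⟩

theorem comp_right {u v : A ⟶ B} (h : StablyEq u v) (w : B ⟶ D) : StablyEq (u ≫ w) (v ≫ w) := by
  obtain ⟨A₀, A₁, i, j, h, e, h₁, h₂⟩ := h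
  refine ⟨_, _, i, j, h, ?_, ?_, ?_⟩
  · rw [← Category.assoc, e, Category.assoc]
  · rw [← Category.assoc]
    exact h₁.comp_right w
  · rw [← Category.assoc]
    exact h₂.comp_right w

variable [HasPullbacks C]

/-- Triviality is invariant under stable equality. -/
theorem isTrivial {u v : A ⟶ B} (h : StablyEq u v) (hu : IsTrivial u) : IsTrivial v := by
  obtain ⟨_, _, i, j, h, e, -, hj⟩ := h
  exact h.isTrivial_of_comp (e ▸ hu.comp_left i) hj

theorem of_comp_mono {u v : A ⟶ B} (w : B ⟶ D) [Mono w] (h : StablyEq (u ≫ w) (v ≫ w)) :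
    StablyEq u v := by
  obtain ⟨_, _, i, j, h, e, h₁, h₂⟩ := h
  simp only [← Category.assoc] at e h₁ h₂
  exact ⟨_, _, i, j, h, (cancel_mono w).1 e, isTrivial_of_comp_mono w h₁,
    isTrivial_of_comp_mono w h₂⟩

variable [FinitaryExtensive C]

theorem of_isTrivial {u v : A ⟶ B} (hu : IsTrivial u) (hv : IsTrivial v) : StablyEq u v := by
  obtain ⟨A', a', h⟩ := isComplementedMono_of_isIso (𝟙 A)
  obtain ⟨hi⟩ := h.isSum.isInitial_of_isIso
  exact ⟨_, _, _, _, h.isSum.symm, hi.hom_ext _ _, hu.comp_left _, hv.comp_left _⟩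

/-- Stable equality may be checked on a summand if both morphisms are trivial on the other one. -/
theorem of_isSum {A₀ A₁ : PreOrd C} {i : A₀ ⟶ A} {j : A₁ ⟶ A} (h : IsSum i j) {u v : A ⟶ B}
    (h₀ : StablyEq (i ≫ u) (i ≫ v)) (h₁ : IsTrivial (j ≫ u)) (h₂ : IsTrivial (j ≫ v)) :
    StablyEq u v := by
  obtain ⟨K₀, K₁, k, l, hk, e, hl₁, hl₂⟩ := h₀
  obtain ⟨V, a, b, hV⟩ := exists_isSum K₁ A₁
  obtain ⟨m, ha, hb⟩ := hV.isCoprod.exists_desc (l ≫ i) j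
  refine ⟨_, _, k ≫ i, m, hk.assoc h hV ha hb, by simpa using e, ?_, ?_⟩
  · refine hV.isTrivial_of_comp ?_ ?_
    · rwa [← Category.assoc, ha, Category.assoc]
    · rwa [← Category.assoc, hb]
  · refine hV.isTrivial_of_comp ?_ ?_
    · rwa [← Category.assoc, ha, Category.assoc]
    · rwa [← Category.assoc, hb]

theorem refl (u : A ⟶ B) : StablyEq u u := by
  obtain ⟨A', a', h⟩ := isComplementedMono_of_isIso (𝟙 A)
  obtain ⟨hi⟩ := h.isSum.isInitial_of_isIso
  exact ⟨_, _, _, _, h.isSum, rfl, isTrivial_of_isInitial hi _, isTrivial_of_isInitial hi _⟩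

theorem comp_left {u v : A ⟶ B} (h : StablyEq u v) (w : D ⟶ A) : StablyEq (w ≫ u) (w ≫ v) := by
  obtain ⟨A₀, A₁, i, j, h, e, h₁, h₂⟩ := h
  obtain ⟨T₁, T₂, t₁, t₂, x, y, ht, hx, hy⟩ := h.split w
  refine ⟨_, _, t₁, t₂, ht, ?_, ?_, ?_⟩
  · simp only [← Category.assoc, hx]
    simp only [Category.assoc, e]
  · rw [← Category.assoc, hy, Category.assoc]
    exact h₁.comp_left y
  · rw [← Category.assoc, hy, Category.assoc]
    exact h₂.comp_left y

theorem trans {u v w : A ⟶ B} (h : StablyEq u v) (h' : StablyEq v w) : StablyEq u w := by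
  obtain ⟨A₀, A₁, i, j, h, e, h₁, h₂⟩ := h
  exact of_isSum h (e ▸ h'.comp_left i) h₁ ((h'.comp_left j).isTrivial h₂)

end StablyEq

end StablyEq

/-! ### Partial morphisms as total morphisms -/

section Partial

variable {C : Type u} [Category.{v} C] [FinitaryExtensive C] [HasPullbacks C] [HasTerminal C]

namespace PartialMap

variable {A B D : PreOrd C}

/-- A partial morphism into `B` is the pullback of a total morphism into the sum of `B` and a point
along the inclusion of `B`. -/
theorem exists_total (p : PartialMap A B) :
    ∃ u : A ⟶ withPoint B, IsPullback p.incl p.map u (inl B) := by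
  obtain ⟨A', a', h⟩ := p.isComplementedMono
  obtain ⟨u, h₁, h₂⟩ := h.isSum.isCoprod.exists_desc (p.map ≫ inl B) (toOne A' ≫ point B)
  exact ⟨u, (isSum_withPoint B).isPullback h₁ h₂ h.isSum⟩

/-- The total morphism that corresponds to a partial morphism: it sends the complement of the
domain of definition to the added point. -/
noncomputable def total (p : PartialMap A B) : A ⟶ withPoint B := p.exists_total.choose

theorem isPullback_total (p : PartialMap A B) : IsPullback p.incl p.map p.total (inl B) :=
  p.exists_total.choose_spec

theorem incl_total (p : PartialMap A B) : p.incl ≫ p.total = p.map ≫ inl B := p.isPullback_total.w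

instance (p : PartialMap A B) : Mono p.incl := p.isComplementedMono.mono

/-- The total morphism is determined by its restriction to the domain of definition and by landing
in `B` nowhere else. -/
theorem eq_total (p : PartialMap A B) {u : A ⟶ withPoint B} (h₁ : p.incl ≫ u = p.map ≫ inl B)
    (h₂ : ∀ {T : PreOrd C} (x : T ⟶ A) (y : T ⟶ B), x ≫ u = y ≫ inl B →
      ∃ z : T ⟶ p.dom, z ≫ p.incl = x) : u = p.total := by
  obtain ⟨A', a', h⟩ := p.isComplementedMono
  -- Both morphisms send the complement to the point, since nothing in it lands in `B`.
  have key : ∀ {v : A ⟶ withPoint B}, (∀ {T : PreOrd C} (x : T ⟶ A) (y : T ⟶ B),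
      x ≫ v = y ≫ inl B → ∃ z : T ⟶ p.dom, z ≫ p.incl = x) → a' ≫ v = toOne A' ≫ point B := by
    intro v hv
    obtain ⟨T₁, T₂, t₁, t₂, x, y, ht, hx, hy⟩ := (isSum_withPoint B).split (a' ≫ v)
    apply ht.isCoprod.hom_ext
    · obtain ⟨z, hz⟩ := hv (t₁ ≫ a') x (by rw [Category.assoc, hx])
      exact (h.isSum.isInitial z t₁ hz).some.hom_ext _ _
    · rw [hy, ← Category.assoc, toOne_unique y]
  refine h.isSum.isCoprod.hom_ext (h₁.trans p.incl_total.symm) ((key h₂).trans (key ?_).symm)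
  exact fun x y w => ⟨p.isPullback_total.lift x y w, p.isPullback_total.lift_fst _ _ _⟩

theorem isTrivial_total_iff (p : PartialMap A B) : IsTrivial p.total ↔ IsTrivial p.map := by
  constructor
  · intro h
    apply isTrivial_of_comp_mono (inl B)
    rw [← incl_total]
    exact h.comp_left _
  · intro h
    obtain ⟨T₁, T₂, t₁, t₂, x, y, ht, hx, hy⟩ := (isSum_withPoint B).split p.total
    refine ht.isTrivial_of_comp ?_ (hy ▸ isTrivial_point y)
    rw [hx, ← p.isPullback_total.lift_snd _ _ hx]
    exact (h.comp_left _).comp_right _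

theorem Equiv.total_eq {p q : PartialMap A B} (h : p.Equiv q) : p.total = q.total := by
  obtain ⟨e, h₁, h₂⟩ := h
  apply eq_total
  · rw [← cancel_epi e.hom, ← Category.assoc, h₁, incl_total, ← Category.assoc, h₂]
  · exact fun x y w => ⟨p.isPullback_total.lift x y w ≫ e.hom, by
      rw [Category.assoc, h₁, p.isPullback_total.lift_fst]⟩

theorem total_ofHom (f : A ⟶ B) : (ofHom f).total = f ≫ inl B :=
  (eq_total _ (Category.id_comp _) fun x _ _ => ⟨x, Category.comp_id x⟩).symm

/-- The extension of the total morphism of a partial morphism that fixes the added point. -/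
theorem exists_bind (q : PartialMap B D) :
    ∃ e : withPoint B ⟶ withPoint D, inl B ≫ e = q.total ∧ point B ≫ e = point D :=
  (isSum_withPoint B).isCoprod.exists_desc _ _

/-- Composition of partial morphisms is composition in the Kleisli category of the monad that adds a
point. -/
theorem total_comp (p : PartialMap A B) (q : PartialMap B D) {e : withPoint B ⟶ withPoint D}
    (h₁ : inl B ≫ e = q.total) (h₂ : point B ≫ e = point D) :
    (p.comp q).total = p.total ≫ e := by
  symm
  apply eq_total
  · simp only [comp, compOf, Category.assoc]
    rw [← Category.assoc p.incl, incl_total, Category.assoc, h₁, ← incl_total, ← Category.assoc,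
      pullback.condition, Category.assoc]
  · intro T x y w
    obtain ⟨T₁, T₂, t₁, t₂, z, z', ht, hz, hz'⟩ := (isSum_withPoint B).split (x ≫ p.total)
    have hw₁ : z ≫ q.total = (t₁ ≫ y) ≫ inl D := by
      rw [Category.assoc, ← w, ← h₁, ← Category.assoc z, ← hz]; simp
    have hw₂ : z' ≫ point D = (t₂ ≫ y) ≫ inl D := by
      rw [Category.assoc, ← w, ← h₂, ← Category.assoc z', ← hz']; simp
    obtain ⟨hi⟩ := (isSum_withPoint D).isInitial _ _ hw₂.symm
    have hl : p.isPullback_total.lift (t₁ ≫ x) z (by rw [Category.assoc, hz]) ≫ p.map =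
        q.isPullback_total.lift z (t₁ ≫ y) hw₁ ≫ q.incl := by
      rw [p.isPullback_total.lift_snd, q.isPullback_total.lift_fst]
    obtain ⟨r, hr₁, hr₂⟩ := ht.isCoprod.exists_desc (pullback.lift _ _ hl) (hi.to _)
    refine ⟨r, ht.isCoprod.hom_ext ?_ (hi.hom_ext _ _)⟩
    change t₁ ≫ r ≫ pullback.fst _ _ ≫ p.incl = _
    rw [← Category.assoc, hr₁, ← Category.assoc, pullback.lift_fst, p.isPullback_total.lift_fst]

end PartialMap


end Partial

/-! ### Partial morphisms modulo the congruence -/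

section Congruence

variable {C : Type u} [Category.{v} C] [FinitaryExtensive C] [HasPullbacks C]

variable {A B D : PreOrd C}

/-- The morphism of the stable category with a given representative. -/
noncomputable def stabMk (p : PartialMap A B) :
    (stabFunctor C).obj A ⟶ (stabFunctor C).obj B :=
  (CategoryTheory.Quotient.functor (stableRel C)).map (PaPreOrd.homMk p)

theorem stabMk_surjective (f : (stabFunctor C).obj A ⟶ (stabFunctor C).obj B) :
    ∃ p : PartialMap A B, stabMk p = f := by
  obtain ⟨g, rfl⟩ := (CategoryTheory.Quotient.functor (stableRel C)).map_surjective f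
  obtain ⟨p, rfl⟩ := PaPreOrd.homMk_surjective g
  exact ⟨p, rfl⟩

theorem stabFunctor_obj_surjective (W : Stab C) : ∃ X, (stabFunctor C).obj X = W :=
  ⟨W.as.toPreOrd, rfl⟩

theorem stabMk_ofHom (f : A ⟶ B) : stabMk (.ofHom f) = (stabFunctor C).map f := rfl

theorem stabMk_comp (p : PartialMap A B) (q : PartialMap B D) {P : PreOrd C} {s : P ⟶ p.dom}
    {t : P ⟶ q.dom} (sq : IsPullback s t p.map q.incl) :
    stabMk p ≫ stabMk q = stabMk (p.compOf q sq) := by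
  refine ((CategoryTheory.Quotient.functor (stableRel C)).map_comp _ _).symm.trans (congrArg _ ?_)
  exact (PaPreOrd.homMk_eq_iff _ _).2 (PartialMap.comp_equiv_compOf p q sq)

theorem stabMk_comp_map (p : PartialMap A B) (f : B ⟶ D) :
    stabMk p ≫ (stabFunctor C).map f =
      stabMk ⟨p.dom, p.incl, p.isComplementedMono, p.map ≫ f⟩ := by
  have sq : IsPullback (𝟙 p.dom) p.map p.map (PartialMap.ofHom f).incl :=
    IsPullback.id_horiz p.map
  rw [← stabMk_ofHom, stabMk_comp _ _ sq]
  simp [PartialMap.compOf, PartialMap.ofHom]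

variable [HasTerminal C]

/-- On the complement of the common subobject of a congruence diagram the total morphism is trivial:
the part of it that lies in the domain of `p` lies in the complement `s.domLeftCompl`. -/
theorem CongruenceDiagram.isTrivial_comp_total {p q : PartialMap A B} (s : CongruenceDiagram p q)
    {A' : PreOrd C} {a' : A' ⟶ A} (h : IsSum s.incl a') : IsTrivial (a' ≫ p.total) := by
  obtain ⟨T₁, T₂, t₁, t₂, x, y, ht, hx, hy⟩ := (isSum_withPoint B).split (a' ≫ p.total)
  refine ht.isTrivial_of_comp ?_ (hy ▸ isTrivial_point y)
  rw [← Category.assoc] at hx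
  have hf := p.isPullback_total.lift_fst _ _ hx
  have hs := p.isPullback_total.lift_snd _ _ hx
  generalize p.isPullback_total.lift _ _ hx = z at hf hs
  rw [← Category.assoc, hx, ← hs]
  refine IsTrivial.comp_right ?_ _
  obtain ⟨S₁, S₂, s₁, s₂, x', y', hS, hx', hy'⟩ := s.areComplements_left.isSum.split z
  refine hS.isTrivial_of_comp ?_ ?_
  · obtain ⟨hi⟩ := h.isInitial x' (s₁ ≫ t₁) (by
      rw [← s.left_incl, ← Category.assoc, ← hx', Category.assoc, hf, Category.assoc])
    exact isTrivial_of_isInitial hi _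
  · rw [← Category.assoc, hy', Category.assoc]
    exact s.isTrivial_left.comp_left y'

/-- A congruence diagram with the roles of the two partial morphisms exchanged. -/
def CongruenceDiagram.symm {p q : PartialMap A B} (s : CongruenceDiagram p q) :
    CongruenceDiagram q p where
  dom := s.dom
  incl := s.incl
  left := s.right
  right := s.left
  domLeftCompl := _
  leftCompl := s.rightCompl
  domRightCompl := _
  rightCompl := s.leftCompl
  isComplementedMono_incl := s.isComplementedMono_incl
  left_incl := s.right_incl
  right_incl := s.left_incl
  areComplements_left := s.areComplements_right
  areComplements_right := s.areComplements_left
  map_eq := s.map_eq.symm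
  isTrivial_left := s.isTrivial_right
  isTrivial_right := s.isTrivial_left

theorem CongruenceDiagram.stablyEq {p q : PartialMap A B} (s : CongruenceDiagram p q) :
    StablyEq p.total q.total := by
  obtain ⟨A', a', h⟩ := s.isComplementedMono_incl
  refine ⟨_, _, s.incl, a', h.isSum, ?_, s.isTrivial_comp_total h.isSum,
    s.symm.isTrivial_comp_total h.isSum⟩
  rw [← s.left_incl, Category.assoc, p.incl_total, s.left_incl, ← s.right_incl, Category.assoc,
    q.incl_total, ← Category.assoc, ← Category.assoc, s.map_eq]

/-- Let `A` be the sum of `V₀`, `V₁` and `A₁`, where `V₀` lies in the domain of `p` by `l`, the total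
morphism of `p` sends `V₁` to the added point, and it is trivial on `A₁`. Then `l` has a complement
in the domain of `p`, on which `p` is trivial. -/
theorem PartialMap.exists_complement {p : PartialMap A B} {V₀ V₁ A₀ A₁ : PreOrd C} {i : A₀ ⟶ A}
    {j : A₁ ⟶ A} (h : IsSum i j) {a : V₀ ⟶ A₀} {b : V₁ ⟶ A₀} (hV : IsSum a b)
    (hj : IsTrivial (j ≫ p.total)) {y : V₁ ⟶ one C} (hy : b ≫ i ≫ p.total = y ≫ point B)
    {l : V₀ ⟶ p.dom} (hl : l ≫ p.incl = a ≫ i) :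
    ∃ (K : PreOrd C) (c : K ⟶ p.dom), AreComplements l c ∧ IsTrivial (c ≫ p.map) := by
  have sq : IsPullback l (𝟙 _) p.incl (l ≫ p.incl) := by
    refine IsPullback.of_isLimit' ⟨by simp⟩ (PullbackCone.IsLimit.mk _ (fun s => s.snd) ?_ ?_ ?_)
    · intro s
      rw [← cancel_mono p.incl, Category.assoc, s.condition]
    · intro s
      simp
    · intro s m _ h₂
      simpa using h₂
  obtain ⟨K, c, hc⟩ : IsComplementedMono l := by
    refine IsComplementedMono.of_isPullback sq ?_
    rw [hl]
    exact IsComplementedMono.comp ⟨_, _, hV.areComplements⟩ ⟨_, _, h.areComplements⟩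
  refine ⟨K, c, hc, ?_⟩
  obtain ⟨K₁, K₂, k₁, k₂, x₁, x₂, hK, hx₁, hx₂⟩ := h.split (c ≫ p.incl)
  refine hK.isTrivial_of_comp ?_ ?_
  · -- On `A₀` the complement of `l` is empty: it meets neither `V₀` nor `V₁`.
    obtain ⟨L₁, L₂, l₁, l₂, z₁, z₂, hL, hz₁, hz₂⟩ := hV.split x₁
    obtain ⟨h₁⟩ := hc.isSum.isInitial z₁ (l₁ ≫ k₁) (by
      rw [← cancel_mono p.incl, Category.assoc, hl, ← Category.assoc, ← hz₁, Category.assoc, ← hx₁]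
      simp)
    obtain ⟨h₂⟩ := (isSum_withPoint B).isInitial (l₂ ≫ k₁ ≫ c ≫ p.map) (z₂ ≫ y) (by
      rw [Category.assoc z₂, ← hy, ← Category.assoc z₂, ← hz₂, Category.assoc l₂ x₁,
        ← Category.assoc x₁, ← hx₁]
      simp [p.incl_total])
    exact hL.isTrivial_of_comp (isTrivial_of_isInitial h₁ _) (isTrivial_of_isInitial h₂ _)
  · refine isTrivial_of_comp_mono (inl B) ?_
    have e : (k₂ ≫ c ≫ p.map) ≫ inl B = x₂ ≫ j ≫ p.total := by
      rw [← Category.assoc x₂, ← hx₂]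
      simp [p.incl_total]
    rw [e]
    exact hj.comp_left x₂

theorem CongruenceDiagram.nonempty_of_stablyEq {p q : PartialMap A B}
    (h : StablyEq p.total q.total) : Nonempty (CongruenceDiagram p q) := by
  obtain ⟨A₀, A₁, i, j, h, e, h₁, h₂⟩ := h
  obtain ⟨V₀, V₁, a, b, x, y, hV, hx, hy⟩ := (isSum_withPoint B).split (i ≫ p.total)
  have hxp : (a ≫ i) ≫ p.total = x ≫ inl B := by rw [Category.assoc, hx]
  have hxq : (a ≫ i) ≫ q.total = x ≫ inl B := by rw [Category.assoc, ← e, hx]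
  have hl := p.isPullback_total.lift_fst _ _ hxp
  have hr := q.isPullback_total.lift_fst _ _ hxq
  obtain ⟨K, c, hc, hct⟩ := PartialMap.exists_complement h hV h₁ hy hl
  obtain ⟨K', c', hc', hct'⟩ := PartialMap.exists_complement h hV h₂ (by rw [← e, hy]) hr
  exact ⟨{
    dom := V₀
    incl := a ≫ i
    left := _
    right := _
    domLeftCompl := K
    leftCompl := c
    domRightCompl := K'
    rightCompl := c'
    isComplementedMono_incl :=
      IsComplementedMono.comp ⟨_, _, hV.areComplements⟩ ⟨_, _, h.areComplements⟩
    left_incl := hl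
    right_incl := hr
    areComplements_left := hc
    areComplements_right := hc'
    map_eq := by rw [p.isPullback_total.lift_snd, q.isPullback_total.lift_snd]
    isTrivial_left := hct
    isTrivial_right := hct' }⟩

/-- Partial morphisms are congruent precisely when their total morphisms are stably equal. -/
theorem stableRel_homMk_iff (p q : PartialMap A B) :
    stableRel C (PaPreOrd.homMk p) (PaPreOrd.homMk q) ↔ StablyEq p.total q.total := by
  constructor
  · rintro ⟨p', q', hp, hq, ⟨s⟩⟩
    rw [← ((PaPreOrd.homMk_eq_iff _ _).1 hp).total_eq, ← ((PaPreOrd.homMk_eq_iff _ _).1 hq).total_eq]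
    exact s.stablyEq
  · exact fun h => ⟨p, q, rfl, rfl, CongruenceDiagram.nonempty_of_stablyEq h⟩

instance : Congruence (stableRel C) where
  equivalence {X Y} := by
    refine ⟨fun f => ?_, fun {f g} h => ?_, fun {f g k} h h' => ?_⟩
    · obtain ⟨p, rfl⟩ := PaPreOrd.homMk_surjective f
      exact (stableRel_homMk_iff p p).2 (.refl _)
    · obtain ⟨p, rfl⟩ := PaPreOrd.homMk_surjective f
      obtain ⟨q, rfl⟩ := PaPreOrd.homMk_surjective g
      exact (stableRel_homMk_iff q p).2 ((stableRel_homMk_iff p q).1 h).symm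
    · obtain ⟨p, rfl⟩ := PaPreOrd.homMk_surjective f
      obtain ⟨q, rfl⟩ := PaPreOrd.homMk_surjective g
      obtain ⟨r, rfl⟩ := PaPreOrd.homMk_surjective k
      exact (stableRel_homMk_iff p r).2
        (((stableRel_homMk_iff p q).1 h).trans ((stableRel_homMk_iff q r).1 h'))
  comp_left {X Y Z} f g g' h := by
    obtain ⟨r, rfl⟩ := PaPreOrd.homMk_surjective f
    obtain ⟨p, rfl⟩ := PaPreOrd.homMk_surjective g
    obtain ⟨q, rfl⟩ := PaPreOrd.homMk_surjective g'
    obtain ⟨e, h₁, h₂⟩ := p.exists_bind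
    obtain ⟨e', h₁', h₂'⟩ := q.exists_bind
    rw [PaPreOrd.homMk_comp, PaPreOrd.homMk_comp, stableRel_homMk_iff, r.total_comp p h₁ h₂,
      r.total_comp q h₁' h₂']
    refine StablyEq.comp_left ?_ _
    refine StablyEq.of_isSum (isSum_withPoint _) ?_ ?_ ?_
    · rw [h₁, h₁']
      exact (stableRel_homMk_iff p q).1 h
    · exact (isTrivialObj_one C).isTrivial _
    · exact (isTrivialObj_one C).isTrivial _
  comp_right {X Y Z} f f' g h := by
    obtain ⟨p, rfl⟩ := PaPreOrd.homMk_surjective f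
    obtain ⟨q, rfl⟩ := PaPreOrd.homMk_surjective f'
    obtain ⟨r, rfl⟩ := PaPreOrd.homMk_surjective g
    obtain ⟨e, h₁, h₂⟩ := r.exists_bind
    rw [PaPreOrd.homMk_comp, PaPreOrd.homMk_comp, stableRel_homMk_iff, p.total_comp r h₁ h₂,
      q.total_comp r h₁ h₂]
    exact ((stableRel_homMk_iff p q).1 h).comp_right e

/-- Equality in the stable category is stable equality of total morphisms. -/
theorem stabMk_eq_iff (p q : PartialMap A B) :
    stabMk p = stabMk q ↔ StablyEq p.total q.total :=
  (CategoryTheory.Quotient.functor_map_eq_iff _ _ _).trans (stableRel_homMk_iff p q)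

theorem stabFunctor_map_eq_iff (u v : A ⟶ B) :
    (stabFunctor C).map u = (stabFunctor C).map v ↔ StablyEq u v := by
  rw [← stabMk_ofHom, ← stabMk_ofHom, stabMk_eq_iff, PartialMap.total_ofHom,
    PartialMap.total_ofHom]
  exact ⟨fun h => h.of_comp_mono, fun h => h.comp_right _⟩

/-- The inverse in the stable category of the inclusion of `B` in the sum of `B` and a point. -/
noncomputable def retract (B : PreOrd C) : PartialMap (withPoint B) B where
  dom := B
  incl := inl B
  isComplementedMono := ⟨_, _, (isSum_withPoint B).areComplements⟩
  map := 𝟙 B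

/-- Up to `withPointIso`, every morphism of the stable category is the image of a morphism of
preorders. -/
theorem map_total_comp_retract (p : PartialMap A B) :
    (stabFunctor C).map p.total ≫ stabMk (retract B) = stabMk p := by
  rw [← stabMk_ofHom,
    stabMk_comp (.ofHom p.total) (retract B) (s := p.incl) (t := p.map) p.isPullback_total]
  simp [PartialMap.compOf, PartialMap.ofHom, retract]

/-- In the stable category, adding a point does not change a preorder. -/
noncomputable def withPointIso (B : PreOrd C) :
    (stabFunctor C).obj (withPoint B) ≅ (stabFunctor C).obj B where
  hom := stabMk (retract B)
  inv := (stabFunctor C).map (inl B)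
  hom_inv_id := by
    rw [stabMk_comp_map, ← CategoryTheory.Functor.map_id, ← stabMk_ofHom, stabMk_eq_iff]
    refine ⟨_, _, _, _, isSum_withPoint B, ?_, ?_, ?_⟩
    · have := PartialMap.incl_total ⟨B, inl B, (retract B).isComplementedMono, 𝟙 B ≫ inl B⟩
      simp only [retract] at this ⊢
      rw [this, PartialMap.total_ofHom]
      simp
    · exact (isTrivialObj_one C).isTrivial _
    · exact (isTrivialObj_one C).isTrivial _
  inv_hom_id := by
    rw [← PartialMap.total_ofHom (𝟙 B)|>.trans (Category.id_comp _), map_total_comp_retract]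
    rfl

theorem stabMk_eq_zero_iff (p : PartialMap A B) : stabMk p = 0 ↔ IsTrivial p.map := by
  let o : PartialMap A B := ⟨_, initial.to A, isComplementedMono_initial A, initial.to B⟩
  have ho : stabMk o = 0 := by
    have e := stabMk_comp_map ⟨_, initial.to A, isComplementedMono_initial A, 𝟙 _⟩ (initial.to B)
    simp only [Category.id_comp] at e
    rw [← e, isZero_stab.eq_of_src ((stabFunctor C).map (initial.to B)) 0, comp_zero]
  have hot : IsTrivial o.total :=
    o.isTrivial_total_iff.2 (isTrivial_of_isInitial initialIsInitial _)
  rw [← ho, stabMk_eq_iff, ← p.isTrivial_total_iff]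
  exact ⟨fun h => h.symm.isTrivial hot, fun h => .of_isTrivial h hot⟩

theorem stabFunctor_map_eq_zero_iff (u : A ⟶ B) : (stabFunctor C).map u = 0 ↔ IsTrivial u := by
  rw [← stabMk_ofHom, stabMk_eq_zero_iff]
  rfl

end Congruence

/-! ### Exactness of the functor to the stable category -/

section Exact

variable {D : Type*} [Category* D] [HasZeroMorphisms D]

theorem isShortExact_of_existsUnique {X Y Z : D} {f : X ⟶ Y} {g : Y ⟶ Z} (w : f ≫ g = 0)
    (hf : ∀ {W : D} (l : W ⟶ Y), l ≫ g = 0 → ∃! l' : W ⟶ X, l' ≫ f = l)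
    (hg : ∀ {W : D} (l : Y ⟶ W), f ≫ l = 0 → ∃! l' : Z ⟶ W, g ≫ l' = l) : IsShortExact f g where
  zero := w
  isKernel := by
    choose lift h₁ h₂ using @hf
    exact ⟨KernelFork.IsLimit.ofι f w lift h₁ fun l hl m hm => h₂ l hl m hm⟩
  isCokernel := by
    choose desc h₁ h₂ using @hg
    exact ⟨CokernelCofork.IsColimit.ofπ g w desc h₁ fun l hl m hm => h₂ l hl m hm⟩

theorem IsShortExact.existsUnique_lift {X Y Z : D} {f : X ⟶ Y} {g : Y ⟶ Z} (h : IsShortExact f g)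
    {W : D} (l : W ⟶ Y) (hl : l ≫ g = 0) : ∃! l' : W ⟶ X, l' ≫ f = l := by
  obtain ⟨s⟩ := h.isKernel
  obtain ⟨l', h'⟩ := KernelFork.IsLimit.lift' s l hl
  exact ⟨l', h', fun m hm => Fork.IsLimit.hom_ext s (hm.trans h'.symm)⟩

theorem IsShortExact.existsUnique_desc {X Y Z : D} {f : X ⟶ Y} {g : Y ⟶ Z} (h : IsShortExact f g)
    {W : D} (l : Y ⟶ W) (hl : f ≫ l = 0) : ∃! l' : Z ⟶ W, g ≫ l' = l := by
  obtain ⟨s⟩ := h.isCokernel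
  obtain ⟨l', h'⟩ := CokernelCofork.IsColimit.desc' s l hl
  exact ⟨l', h', fun m hm => Cofork.IsColimit.hom_ext s (hm.trans h'.symm)⟩

theorem IsShortExact.of_iso {X Y Z X' Y' Z' : D} {f : X ⟶ Y} {g : Y ⟶ Z} {f' : X' ⟶ Y'}
    {g' : Y' ⟶ Z'} (h : IsShortExact f' g') (a : X ≅ X') (b : Y ≅ Y') (d : Z ≅ Z')
    (hf : f ≫ b.hom = a.hom ≫ f') (hg : g ≫ d.hom = b.hom ≫ g') : IsShortExact f g := by
  have hf' : f = a.hom ≫ f' ≫ b.inv := by rw [← Category.assoc, ← hf]; simp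
  have hg' : g = b.hom ≫ g' ≫ d.inv := by rw [← Category.assoc, ← hg]; simp
  subst hf' hg'
  refine isShortExact_of_existsUnique ?_ ?_ ?_
  · simp [reassoc_of% h.zero]
  · intro W l hl
    obtain ⟨m, hm, hu⟩ := h.existsUnique_lift (l ≫ b.hom)
      (by rw [← cancel_mono d.inv]; simpa using hl)
    refine ⟨m ≫ a.inv, by simp [reassoc_of% hm], fun n hn => ?_⟩
    rw [← hu (n ≫ a.hom) (by simp [← hn])]
    simp
  · intro W l hl
    obtain ⟨m, hm, hu⟩ := h.existsUnique_desc (b.inv ≫ l)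
      (by rw [← cancel_epi a.hom]; simpa using hl)
    refine ⟨d.hom ≫ m, by simp [hm], fun n hn => ?_⟩
    rw [← hu (d.inv ≫ n) (by simp [← hn])]
    simp

end Exact

section Preservation

variable {C : Type u} [Category.{v} C] [FinitaryExtensive C] [HasPullbacks C] [HasTerminal C]

theorem mono_stabFunctor_map {X Y : PreOrd C} (k : X ⟶ Y) [Mono k] :
    Mono ((stabFunctor C).map k) where
  right_cancellation {W} x y w := by
    obtain ⟨W, rfl⟩ := stabFunctor_obj_surjective W
    obtain ⟨x, rfl⟩ := stabMk_surjective x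
    obtain ⟨y, rfl⟩ := stabMk_surjective y
    obtain ⟨e, h₁, h₂⟩ := (PartialMap.ofHom k).exists_bind
    -- The extension of `k` to the sums with a point is monic.
    have : Mono e := by
      have hX := isSum_withPoint X
      have hY := isSum_withPoint Y
      have h₁' : inl X ≫ e = k ≫ inl Y := h₁.trans (PartialMap.total_ofHom k)
      have hi := mono_base (k ≫ inl Y)
      have hp := hY.base.mono_right
      rw [← h₁'] at hi
      rw [← h₂] at hp
      refine mono_of_mono_base e (hX.base.mono_of_disjoint _ hi hp fun a b hab => ?_)
      refine hY.base.isInitial (a ≫ Hom.base k) b ?_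
      have h₁'' := congrArg Hom.base h₁'
      have h₂' := congrArg Hom.base h₂
      simp only [comp_base] at h₁'' h₂'
      rw [Category.assoc, ← h₁'', hab, h₂']
    have hc (p : PartialMap W X) : stabMk p ≫ (stabFunctor C).map k =
        stabMk (p.comp (.ofHom k)) := stabMk_comp p (.ofHom k) _
    rw [hc, hc, stabMk_eq_iff, PartialMap.total_comp _ _ h₁ h₂,
      PartialMap.total_comp _ _ h₁ h₂] at w
    exact (stabMk_eq_iff _ _).2 (w.of_comp_mono e)

/-- The functor to the stable category sends `Z`-kernels to kernels. -/
theorem PreOrd.IsZKernel.existsUnique_stab {X Y Z : PreOrd C} {k : X ⟶ Y}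
    {q : Y ⟶ Z} (h : IsZKernel k q) {W : Stab C} (l : W ⟶ (stabFunctor C).obj Y)
    (hl : l ≫ (stabFunctor C).map q = 0) :
    ∃! l' : W ⟶ (stabFunctor C).obj X, l' ≫ (stabFunctor C).map k = l := by
  obtain ⟨W, rfl⟩ := stabFunctor_obj_surjective W
  have := h.mono
  obtain ⟨p, rfl⟩ := stabMk_surjective l
  rw [stabMk_comp_map, stabMk_eq_zero_iff] at hl
  obtain ⟨m, hm, -⟩ := h.existsUnique_lift p.map hl
  have := mono_stabFunctor_map k
  have e : stabMk ⟨p.dom, p.incl, p.isComplementedMono, m⟩ ≫ (stabFunctor C).map k = stabMk p := by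
    simp only [stabMk_comp_map, hm]
  exact ⟨_, e, fun n hn => (cancel_mono _).1 (hn.trans e.symm)⟩

/-- A complemented subobject of the domain of a `Z`-cokernel descends to its codomain, because
its characteristic morphism into the sum of two points has a trivial codomain. -/
theorem PreOrd.IsZCokernel.exists_isSum {X Y Z : PreOrd C} {k : X ⟶ Y}
    {q : Y ⟶ Z} (h : IsZCokernel q k) {Y₀ Y₁ : PreOrd C} {i₀ : Y₀ ⟶ Y} {i₁ : Y₁ ⟶ Y}
    (hY : IsSum i₀ i₁) : ∃ (Z₀ Z₁ : PreOrd C) (j₀ : Z₀ ⟶ Z) (j₁ : Z₁ ⟶ Z) (q₀ : Y₀ ⟶ Z₀)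
      (q₁ : Y₁ ⟶ Z₁), IsSum j₀ j₁ ∧ i₀ ≫ q = q₀ ≫ j₀ ∧ i₁ ≫ q = q₁ ≫ j₁ := by
  have h₂ := isSum_withPoint (one C)
  have ht : (withPoint (one C)).IsTrivialObj :=
    h₂.isTrivialObj (isTrivialObj_one C) (isTrivialObj_one C)
  obtain ⟨χ, hχ₀, hχ₁⟩ := hY.isCoprod.exists_desc (toOne Y₀ ≫ inl (one C))
    (toOne Y₁ ≫ point (one C))
  obtain ⟨χ', rfl, -⟩ := h.existsUnique_desc χ ⟨_, k ≫ χ, 𝟙 _, ht, Category.comp_id _⟩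
  obtain ⟨Z₀, Z₁, j₀, j₁, x, y, hZ, hx, hy⟩ := h₂.split χ'
  have sq₀ := h₂.isPullback hx hy hZ
  have sq₁ := h₂.isPullback_right hx hy hZ
  exact ⟨Z₀, Z₁, j₀, j₁, sq₀.lift (i₀ ≫ q) (toOne _) (by simpa using hχ₀),
    sq₁.lift (i₁ ≫ q) (toOne _) (by simpa using hχ₁), hZ, (sq₀.lift_fst _ _ _).symm,
    (sq₁.lift_fst _ _ _).symm⟩

/-- If `u` is trivial on the inverse image of a complemented subobject along a `Z`-cokernel, then
it is trivial on that subobject. -/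
theorem PreOrd.IsZCokernel.isTrivial_of_comp {X Y Z S : PreOrd C} {k : X ⟶ Y}
    {q : Y ⟶ Z} (h : IsZCokernel q k) {Y₀ Y₁ : PreOrd C} {i₀ : Y₀ ⟶ Y} {i₁ : Y₁ ⟶ Y}
    (hY : IsSum i₀ i₁) {Z₀ Z₁ : PreOrd C} {j₀ : Z₀ ⟶ Z} {j₁ : Z₁ ⟶ Z} {q₀ : Y₀ ⟶ Z₀}
    {q₁ : Y₁ ⟶ Z₁} (hZ : IsSum j₀ j₁) (h₀ : i₀ ≫ q = q₀ ≫ j₀) (h₁ : i₁ ≫ q = q₁ ≫ j₁)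
    {u : Z₁ ⟶ S} (hu : IsTrivial (q₁ ≫ u)) : IsTrivial u := by
  have := h.epi
  obtain ⟨T, a, b, hT, hab⟩ := hu
  -- The factorisation through a trivial object extends by a point to all of `Y`, and so descends.
  obtain ⟨w, hw₁, hw₀⟩ := hY.symm.isCoprod.exists_desc (a ≫ inl T) (toOne Y₀ ≫ point T)
  obtain ⟨w', rfl, -⟩ := h.existsUnique_desc w ⟨_, k ≫ w, 𝟙 _,
    (isSum_withPoint T).isTrivialObj hT (isTrivialObj_one C), Category.comp_id _⟩
  obtain ⟨e, he₁, he₂⟩ := (isSum_withPoint T).isCoprod.exists_desc (b ≫ inl S) (point S)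
  obtain ⟨r, hr₁, hr₀⟩ := hZ.symm.isCoprod.exists_desc (u ≫ inl S) (toOne Z₀ ≫ point S)
  have key : w' ≫ e = r := by
    rw [← cancel_epi q]
    apply hY.isCoprod.hom_ext
    · rw [reassoc_of% hw₀, he₂, reassoc_of% h₀, hr₀, ← Category.assoc q₀,
        toOne_unique (q₀ ≫ toOne Z₀)]
    · rw [reassoc_of% hw₁, he₁, reassoc_of% hab, reassoc_of% h₁, hr₁]
  apply isTrivial_of_comp_mono (inl S)
  rw [← hr₁, ← key]
  exact ⟨_, j₁ ≫ w', e, (isSum_withPoint T).isTrivialObj hT (isTrivialObj_one C),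
    Category.assoc _ _ _⟩

/-- A `Z`-cokernel remains an epimorphism up to stable equality, since the decomposition of its
domain that witnesses a stable equality descends to its codomain. -/
theorem PreOrd.IsZCokernel.stablyEq_of_comp {X Y Z S : PreOrd C} {k : X ⟶ Y}
    {q : Y ⟶ Z} (h : IsZCokernel q k) {u v : Z ⟶ S} (huv : StablyEq (q ≫ u) (q ≫ v)) :
    StablyEq u v := by
  have := h.epi
  obtain ⟨Y₀, Y₁, i₀, i₁, hY, e, hu, hv⟩ := huv
  obtain ⟨Z₀, Z₁, j₀, j₁, q₀, q₁, hZ, h₀, h₁⟩ := h.exists_isSum hY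
  rw [reassoc_of% h₁] at hu hv
  refine ⟨Z₀, Z₁, j₀, j₁, hZ, ?_, h.isTrivial_of_comp hY hZ h₀ h₁ hu,
    h.isTrivial_of_comp hY hZ h₀ h₁ hv⟩
  -- Replacing `v` by `u` on `Z₁` gives a morphism that agrees with `u` after the epimorphism `q`.
  obtain ⟨v', hv₀, hv₁⟩ := hZ.isCoprod.exists_desc (j₀ ≫ v) (j₁ ≫ u)
  have key : u = v' := by
    rw [← cancel_epi q]
    apply hY.isCoprod.hom_ext
    · rw [e, reassoc_of% h₀, reassoc_of% h₀, hv₀]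
    · rw [reassoc_of% h₁, reassoc_of% h₁, hv₁]
  rw [key, hv₀]

/-- The functor to the stable category sends `Z`-cokernels to cokernels. -/
theorem PreOrd.IsZCokernel.existsUnique_stab {X Y Z : PreOrd C} {k : X ⟶ Y}
    {q : Y ⟶ Z} (h : IsZCokernel q k) {W : Stab C} (l : (stabFunctor C).obj Y ⟶ W)
    (hl : (stabFunctor C).map k ≫ l = 0) :
    ∃! l' : (stabFunctor C).obj Z ⟶ W, (stabFunctor C).map q ≫ l' = l := by
  obtain ⟨W, rfl⟩ := stabFunctor_obj_surjective W
  obtain ⟨p, rfl⟩ := stabMk_surjective l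
  have e : (stabFunctor C).map (k ≫ p.total) = 0 := by
    rw [← cancel_mono (withPointIso W).hom, zero_comp, Functor.map_comp, Category.assoc]
    exact (congrArg _ (map_total_comp_retract p)).trans hl
  obtain ⟨m, hm, -⟩ := h.existsUnique_desc p.total ((stabFunctor_map_eq_zero_iff _).1 e)
  refine existsUnique_of_exists_of_unique
    ⟨(stabFunctor C).map m ≫ (withPointIso W).hom, ?_⟩ fun x y hx hy => ?_
  · rw [← Category.assoc, ← Functor.map_comp, hm]
    exact map_total_comp_retract p
  · obtain ⟨x, rfl⟩ := stabMk_surjective x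
    obtain ⟨y, rfl⟩ := stabMk_surjective y
    rw [stabMk_eq_iff]
    apply h.stablyEq_of_comp
    rw [← stabFunctor_map_eq_iff, ← cancel_mono (withPointIso W).hom, Functor.map_comp,
      Functor.map_comp, Category.assoc, Category.assoc]
    exact (congrArg _ (map_total_comp_retract x)).trans
      ((hx.trans hy.symm).trans (congrArg _ (map_total_comp_retract y)).symm)

theorem PreOrd.IsShortZExact.stab {X Y Z : PreOrd C} {k : X ⟶ Y} {q : Y ⟶ Z}
    (h : IsShortZExact k q) : IsShortExact ((stabFunctor C).map k) ((stabFunctor C).map q) :=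
  isShortExact_of_existsUnique
    (by rw [← Functor.map_comp, stabFunctor_map_eq_zero_iff]; exact h.isZKernel.trivial)
    (fun l hl => h.isZKernel.existsUnique_stab l hl)
    (fun l hl => h.isZCokernel.existsUnique_stab l hl)

end Preservation

/-! ### Existence of kernels and cokernels relative to trivial morphisms -/

section ZKernels

variable {C : Type u} [Category.{v} C]

/-- `Z`-kernels exist: the `Z`-kernel of `q` has the same carrier, two elements being related if
they are related in the domain of `q` and have the same image under `q`. -/
theorem PreOrd.exists_isZKernel [HasFiniteLimits C] {Y Z : PreOrd C} (q : Y ⟶ Z) :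
    ∃ (X : PreOrd C) (k : X ⟶ Y), IsZKernel k q := by
  let ι := equalizer.ι (Y.fst ≫ Hom.base q) (Y.snd ≫ Hom.base q)
  have hι : ι ≫ Y.fst ≫ Hom.base q = ι ≫ Y.snd ≫ Hom.base q := equalizer.condition _ _
  let X : PreOrd C := ofElements Y.carrier
    (equalizer (Y.fst ≫ Hom.base q) (Y.snd ≫ Hom.base q)) (ι ≫ Y.fst) (ι ≫ Y.snd)
    (fun g h w₁ w₂ => equalizer.hom_ext (Y.rel_ext (by simpa using w₁) (by simpa using w₂)))
    (by
      obtain ⟨r, h₁, h₂⟩ := Y.exists_refl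
      refine ⟨equalizer.lift r (by rw [reassoc_of% h₁, reassoc_of% h₂]), ?_, ?_⟩
      · rw [← Category.assoc, equalizer.lift_ι, h₁]
      · rw [← Category.assoc, equalizer.lift_ι, h₂])
    (by
      intro T a b w
      obtain ⟨c, h₁, h₂⟩ := Y.exists_trans (a ≫ ι) (b ≫ ι) (by simpa using w)
      simp only [Category.assoc] at h₁ h₂
      refine ⟨equalizer.lift c ?_, ?_, ?_⟩
      · rw [reassoc_of% h₁, reassoc_of% h₂, hι, reassoc_of% w, hι]
      · rw [← Category.assoc, equalizer.lift_ι, h₁]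
      · rw [← Category.assoc, equalizer.lift_ι, h₂])
  let k : X ⟶ Y := ⟨𝟙 _, ι, (Category.comp_id _).symm, (Category.comp_id _).symm⟩
  have hk : Mono k := mono_of_mono_base k (inferInstanceAs (Mono (𝟙 Y.carrier)))
  refine ⟨X, k, ?_, fun {W} l hl => ?_⟩
  · rw [isTrivial_iff]
    simpa [X, k] using hι
  · rw [isTrivial_iff] at hl
    let l' : W ⟶ X := ⟨Hom.base (Y := Y) l, equalizer.lift (Hom.rel (Y := Y) l) (by
        rw [← Category.assoc, l.rel_fst, ← Category.assoc, l.rel_snd]; simpa using hl),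
      by rw [← Category.assoc, equalizer.lift_ι, l.rel_fst],
      by rw [← Category.assoc, equalizer.lift_ι, l.rel_snd]⟩
    have e : l' ≫ k = l := hom_ext (Category.comp_id (Hom.base (Y := Y) l))
    exact ⟨l', e, fun m hm => (cancel_mono k).1 (hm.trans e.symm)⟩

end ZKernels

section ZCokernels

variable {C : Type u} [Category.{v} C]

attribute [local simp] prod.lift_fst prod.lift_snd prod.map_fst prod.map_snd coprod.inl_desc
  coprod.inr_desc coprod.inl_desc_assoc coprod.inr_desc_assoc

/-- The image of a span, as a jointly monic pair. -/
theorem exists_image [Regular C] {R A : C} (r₁ r₂ : R ⟶ A) :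
    ∃ (I : C) (e : R ⟶ I) (i₁ i₂ : I ⟶ A), StrongEpi e ∧ JointlyMono₂ i₁ i₂ ∧
      e ≫ i₁ = r₁ ∧ e ≫ i₂ = r₂ := by
  let F := Regular.strongEpiMonoFactorisation (prod.lift r₁ r₂)
  refine ⟨F.I, F.e, F.m ≫ prod.fst, F.m ≫ prod.snd, inferInstance, ⟨fun _ g h w₁ w₂ => ?_⟩, ?_, ?_⟩
  · rw [← cancel_mono F.m]
    exact Limits.prod.hom_ext (by simpa using w₁) (by simpa using w₂)
  · rw [← Category.assoc, F.fac, prod.lift_fst]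
  · rw [← Category.assoc, F.fac, prod.lift_snd]

/-- The universal property of the image of a span: strong epimorphisms lift against jointly monic
pairs. -/
theorem exists_lift_of_strongEpi [HasFiniteLimits C] {R I S A : C} (e : R ⟶ I) [StrongEpi e]
    {s₁ s₂ : S ⟶ A} (hs : JointlyMono₂ s₁ s₂) {i₁ i₂ : I ⟶ A} (g : R ⟶ S)
    (h₁ : g ≫ s₁ = e ≫ i₁) (h₂ : g ≫ s₂ = e ≫ i₂) : ∃ d : I ⟶ S, d ≫ s₁ = i₁ ∧ d ≫ s₂ = i₂ := by
  have : Mono (prod.lift s₁ s₂) := ⟨fun g h w => hs.right_cancellation g h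
    (by simpa using w =≫ prod.fst) (by simpa using w =≫ prod.snd)⟩
  have sq : CommSq g e (prod.lift s₁ s₂) (prod.lift i₁ i₂) :=
    ⟨Limits.prod.hom_ext (by simpa using h₁) (by simpa using h₂)⟩
  exact ⟨sq.lift, by simpa using sq.fac_right =≫ prod.fst, by simpa using sq.fac_right =≫ prod.snd⟩

/-- The inverse image of the relation of a preorder along a morphism into its carrier. -/
theorem exists_inverseImage [HasFiniteLimits C] {A : C} (W : PreOrd C) (l : A ⟶ W.carrier) :
    ∃ (P : C) (p₁ p₂ : P ⟶ A) (w : P ⟶ W.rel), JointlyMono₂ p₁ p₂ ∧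
      w ≫ W.fst = p₁ ≫ l ∧ w ≫ W.snd = p₂ ≫ l ∧
      ∀ {U : C} (x y : U ⟶ A) (r : U ⟶ W.rel), r ≫ W.fst = x ≫ l → r ≫ W.snd = y ≫ l →
        ∃ c : U ⟶ P, c ≫ p₁ = x ∧ c ≫ p₂ = y := by
  let P := pullback (prod.map l l) (prod.lift W.fst W.snd)
  let p₁ : P ⟶ A := pullback.fst _ _ ≫ prod.fst
  let p₂ : P ⟶ A := pullback.fst _ _ ≫ prod.snd
  let w : P ⟶ W.rel := pullback.snd _ _
  have hw : pullback.fst _ _ ≫ prod.map l l = w ≫ prod.lift W.fst W.snd := pullback.condition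
  have hw₁ : w ≫ W.fst = p₁ ≫ l := by simpa [p₁] using (hw =≫ prod.fst).symm
  have hw₂ : w ≫ W.snd = p₂ ≫ l := by simpa [p₂] using (hw =≫ prod.snd).symm
  refine ⟨P, p₁, p₂, w, ⟨fun _ g h u₁ u₂ => ?_⟩, hw₁, hw₂, fun x y r e₁ e₂ => ?_⟩
  · apply pullback.hom_ext
    · exact Limits.prod.hom_ext (by simpa [p₁] using u₁) (by simpa [p₂] using u₂)
    · change g ≫ w = h ≫ w
      apply W.rel_ext
      · rw [Category.assoc, hw₁, ← Category.assoc, u₁, Category.assoc, ← hw₁, Category.assoc]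
      · rw [Category.assoc, hw₂, ← Category.assoc, u₂, Category.assoc, ← hw₂, Category.assoc]
  · refine ⟨pullback.lift (prod.lift x y) r
      (Limits.prod.hom_ext (by simpa using e₁.symm) (by simpa using e₂.symm)), ?_, ?_⟩
    · rw [← Category.assoc, pullback.lift_fst, prod.lift_fst]
    · rw [← Category.assoc, pullback.lift_fst, prod.lift_snd]

/-- The internal preorder generated by a span `(r₁, r₂)` on `A`: the transitive closure of the image
of the span and the diagonal. It is characterised by the morphisms out of it. -/
theorem exists_generated [TauPretopos C] {R A : C} (r₁ r₂ : R ⟶ A) :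
    ∃ (T : C) (t₁ t₂ : T ⟶ A), Nonempty (ReflexiveRelation t₁ t₂) ∧
      Nonempty (TransitiveRelation t₁ t₂) ∧ RelLE r₁ r₂ t₁ t₂ ∧
      ∀ (W : PreOrd C) (l : A ⟶ W.carrier) (g : R ⟶ W.rel), g ≫ W.fst = r₁ ≫ l →
        g ≫ W.snd = r₂ ≫ l → ∃ d : T ⟶ W.rel, d ≫ W.fst = t₁ ≫ l ∧ d ≫ W.snd = t₂ ≫ l := by
  obtain ⟨I, e, i₁, i₂, he, hi, h₁, h₂⟩ := exists_image (coprod.desc r₁ (𝟙 A)) (coprod.desc r₂ (𝟙 A))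
  obtain ⟨T, t₁, t₂, ht⟩ := TauPretopos.exists_transitiveClosure i₁ i₂ hi
  obtain ⟨j, hj₁, hj₂⟩ := ht.le
  refine ⟨T, t₁, t₂, ⟨{ right_cancellation := ht.transitive.some.right_cancellation
                        r := coprod.inr ≫ e ≫ j
                        reflexivity₁ := by simp [hj₁, h₁]
                        reflexivity₂ := by simp [hj₂, h₂] }⟩, ht.transitive,
    ⟨coprod.inl ≫ e ≫ j, by simp [hj₁, h₁], by simp [hj₂, h₂]⟩, fun W l g hg₁ hg₂ => ?_⟩
  obtain ⟨P, p₁, p₂, w, hP, hw₁, hw₂, lift⟩ := exists_inverseImage W l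
  have hPt : Nonempty (TransitiveRelation p₁ p₂) := by
    obtain ⟨m, hm₁, hm₂⟩ := W.exists_trans (pullback.fst p₂ p₁ ≫ w) (pullback.snd p₂ p₁ ≫ w)
      (by rw [Category.assoc, hw₂, pullback.condition_assoc, Category.assoc, hw₁])
    obtain ⟨c, hc₁, hc₂⟩ := lift (pullback.fst p₂ p₁ ≫ p₁) (pullback.snd p₂ p₁ ≫ p₂) m
      (by rw [hm₁, Category.assoc, hw₁, Category.assoc])
      (by rw [hm₂, Category.assoc, hw₂, Category.assoc])
    exact ⟨{ right_cancellation := hP.right_cancellation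
             c := _
             isLimit := pullbackIsPullback p₂ p₁
             t := c
             transitivity₁ := hc₁
             transitivity₂ := hc₂ }⟩
  obtain ⟨x, hx₁, hx₂⟩ := W.exists_refl
  obtain ⟨c, hc₁, hc₂⟩ := lift (coprod.desc r₁ (𝟙 A)) (coprod.desc r₂ (𝟙 A)) (coprod.desc g (l ≫ x))
    (by apply coprod.hom_ext <;> simp [hg₁, hx₁]) (by apply coprod.hom_ext <;> simp [hg₂, hx₂])
  obtain ⟨d, hd₁, hd₂⟩ := ht.minimal p₁ p₂ hPt
    (exists_lift_of_strongEpi e hP c (hc₁.trans h₁.symm) (hc₂.trans h₂.symm))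
  exact ⟨d ≫ w, by rw [Category.assoc, hw₁, reassoc_of% hd₁],
    by rw [Category.assoc, hw₂, reassoc_of% hd₂]⟩

/-- Coequalizers exist in a `τ`-pretopos: the preorder that is generated by a symmetric span is an
equivalence relation, and so is a kernel pair. -/
theorem hasCoequalizer [TauPretopos C] {R A : C} (u v : R ⟶ A) : HasCoequalizer u v := by
  obtain ⟨T, t₁, t₂, hr, ht, ⟨i, hi₁, hi₂⟩, hd⟩ :=
    exists_generated (coprod.desc u v) (coprod.desc v u)
  let P : PreOrd C := ⟨A, T, t₁, t₂, hr, ht⟩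
  let Q : PreOrd C := ofElements A T t₂ t₁ (fun g h w₁ w₂ => P.rel_ext w₂ w₁)
    (let ⟨r, h₁, h₂⟩ := P.exists_refl; ⟨r, h₂, h₁⟩)
    (fun a b w => let ⟨c, h₁, h₂⟩ := P.exists_trans b a w.symm; ⟨c, h₂, h₁⟩)
  have hQ₁ : i ≫ Q.fst = coprod.desc v u := hi₂
  have hQ₂ : i ≫ Q.snd = coprod.desc u v := hi₁
  obtain ⟨s, hs₁, hs₂⟩ := hd Q (𝟙 A) (coprod.desc (coprod.inr ≫ i) (coprod.inl ≫ i))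
    (by apply coprod.hom_ext <;> simp [hQ₁]) (by apply coprod.hom_ext <;> simp [hQ₂])
  have hE : IsEquivalenceRelation t₁ t₂ :=
    ⟨⟨{ __ := hr.some
        __ := ht.some
        s := s
        symmetry₁ := by simpa [Q] using hs₂
        symmetry₂ := by simpa [Q] using hs₁ }⟩⟩
  obtain ⟨Y, q, hq⟩ := Pretopos.exists_isKernelPair t₁ t₂ hE
  have := Regular.hasCoequalizer_of_isKernelPair hq
  refine ⟨⟨⟨Cofork.ofπ (coequalizer.π t₁ t₂) ?_, Cofork.IsColimit.mk' _ fun c => ?_⟩⟩⟩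
  · have h := i ≫= coequalizer.condition t₁ t₂
    rw [reassoc_of% hi₁, reassoc_of% hi₂] at h
    simpa using coprod.inl ≫= h
  · have hc : t₁ ≫ c.π = t₂ ≫ c.π := by
      obtain ⟨d, hd₁, hd₂⟩ := hd (disc c.pt) c.π (coprod.desc (u ≫ c.π) (u ≫ c.π))
        (by apply coprod.hom_ext <;> simp [c.condition])
        (by apply coprod.hom_ext <;> simp [c.condition])
      simpa [hd₁] using hd₂
    exact ⟨coequalizer.desc c.π hc, coequalizer.π_desc _ _, fun {m} hm =>
      coequalizer.hom_ext (hm.trans (coequalizer.π_desc _ _).symm)⟩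

/-- `Z`-cokernels exist in a `τ`-pretopos: the carrier of the `Z`-cokernel of `k : X ⟶ Y` is the
coequalizer of the two projections of `X` into `Y`, with the preorder generated by that of `Y`. -/
theorem PreOrd.exists_isZCokernel [TauPretopos C] {X Y : PreOrd C} (k : X ⟶ Y) :
    ∃ (Z : PreOrd C) (q : Y ⟶ Z), IsZCokernel q k := by
  have := hasCoequalizer (X.fst ≫ Hom.base k) (X.snd ≫ Hom.base k)
  let π := coequalizer.π (X.fst ≫ Hom.base k) (X.snd ≫ Hom.base k)
  obtain ⟨T, t₁, t₂, hr, ht, ⟨i, hi₁, hi₂⟩, hd⟩ := exists_generated (Y.fst ≫ π) (Y.snd ≫ π)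
  let Z : PreOrd C := ⟨_, T, t₁, t₂, hr, ht⟩
  let q : Y ⟶ Z := ⟨π, i, hi₁, hi₂⟩
  have hq : Epi q := ⟨fun a b w => hom_ext (coequalizer.hom_ext (congrArg Hom.base w))⟩
  refine ⟨Z, q, ?_, fun {W} l hl => ?_⟩
  · rw [isTrivial_iff]
    simpa [q] using coequalizer.condition (X.fst ≫ Hom.base k) (X.snd ≫ Hom.base k)
  · rw [isTrivial_iff] at hl
    have hl' : (X.fst ≫ Hom.base k) ≫ Hom.base l = (X.snd ≫ Hom.base k) ≫ Hom.base l := by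
      simpa using hl
    let b := coequalizer.desc (Hom.base l) hl'
    have hb : π ≫ b = Hom.base l := coequalizer.π_desc _ _
    obtain ⟨d, hd₁, hd₂⟩ := hd W b (Hom.rel l) (by rw [l.rel_fst, Category.assoc, hb])
      (by rw [l.rel_snd, Category.assoc, hb])
    let l' : Z ⟶ W := ⟨b, d, hd₁, hd₂⟩
    have e : q ≫ l' = l := hom_ext hb
    exact ⟨l', e, fun m hm => (cancel_epi q).1 (hm.trans e.symm)⟩

end ZCokernels

end StableCategory

theorem mainTheorem4 (C : Type u) [Category.{v} C] [TauPretopos C] {A B D : Stab C}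
    (f : A ⟶ B) (g : B ⟶ D) :
    IsShortExact f g ↔
      ∃ (X Y Z : PreOrd C) (k : X ⟶ Y) (q : Y ⟶ Z), PreOrd.IsShortZExact k q ∧
        ∃ (a : A ≅ (stabFunctor C).obj X) (b : B ≅ (stabFunctor C).obj Y)
          (d : D ≅ (stabFunctor C).obj Z),
          f ≫ b.hom = a.hom ≫ (stabFunctor C).map k ∧
          g ≫ d.hom = b.hom ≫ (stabFunctor C).map q := by
  constructor
  · intro h
    obtain ⟨B, rfl⟩ := stabFunctor_obj_surjective B
    obtain ⟨D, rfl⟩ := stabFunctor_obj_surjective D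
    obtain ⟨p, rfl⟩ := stabMk_surjective g
    obtain ⟨X, k, hk⟩ := PreOrd.exists_isZKernel p.total
    obtain ⟨Z, q, hq⟩ := PreOrd.exists_isZCokernel k
    have hkq := hk.isShortZExact hq
    -- Both `f` and the image of `k` are kernels of `p`, as `p` is isomorphic to its total morphism.
    have hp {W : Stab C} (l : W ⟶ (stabFunctor C).obj B) :
        l ≫ stabMk p = 0 ↔ l ≫ (stabFunctor C).map p.total = 0 := by
      have e : (stabFunctor C).map p.total ≫ (withPointIso D).hom = stabMk p :=
        map_total_comp_retract p
      rw [← e, ← Category.assoc, ← cancel_mono (withPointIso D).hom, Limits.zero_comp]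
    have hw : (stabFunctor C).map k ≫ stabMk p = 0 := by
      rw [hp, ← Functor.map_comp, stabFunctor_map_eq_zero_iff]
      exact hk.trivial
    obtain ⟨x, hx, -⟩ := h.existsUnique_lift _ hw
    obtain ⟨y, hy, -⟩ := hk.existsUnique_stab f ((hp f).1 h.zero)
    have := hk.mono
    have := mono_stabFunctor_map k
    have hyx : y ≫ x = 𝟙 _ := by
      refine (h.existsUnique_lift f h.zero).unique ?_ (Category.id_comp f)
      rw [Category.assoc, hx, hy]
    have hxy : x ≫ y = 𝟙 _ := by
      rw [← cancel_mono ((stabFunctor C).map k), Category.assoc, hy, hx, Category.id_comp]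
    let a : A ≅ (stabFunctor C).obj X := ⟨y, x, hyx, hxy⟩
    have hfq : IsShortExact f ((stabFunctor C).map q) :=
      hkq.stab.of_iso a (Iso.refl _) (Iso.refl _) (by simp [a, hy]) (by simp)
    -- Both `p` and the image of `q` are cokernels of `f`.
    obtain ⟨z, hz, -⟩ := h.existsUnique_desc _ hfq.zero
    obtain ⟨t, ht, -⟩ := hfq.existsUnique_desc _ h.zero
    have hzt : z ≫ t = 𝟙 _ := by
      refine (h.existsUnique_desc _ h.zero).unique ?_ (Category.comp_id _)
      rw [reassoc_of% hz, ht]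
    have htz : t ≫ z = 𝟙 _ := by
      refine (hfq.existsUnique_desc _ hfq.zero).unique ?_ (Category.comp_id _)
      rw [reassoc_of% ht, hz]
    exact ⟨X, _, Z, k, q, hkq, a, Iso.refl _, ⟨z, t, hzt, htz⟩, by simp [a, hy], by simp [hz]⟩
  · rintro ⟨X, Y, Z, k, q, h, a, b, d, hf, hg⟩
    exact h.stab.of_iso a b d hf hg
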